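/- Let $n\ge 1$ and $0\le\alpha<n$. Let $p(\cdot),q(\cdot):\mathbb R^n\to[1,\infty]$ be Lebesgue measurable functions with $$\frac1{p(x)}-\frac1{q(x)}=\frac{\alpha}{n}\qquad\text{for almost every }x\in\mathbb R^n$$ (with $1/\infty=0$; in particular $p(x)\le n/\alpha$ a.e.), and put $p_-=\operatorname{ess\,inf}_{\mathbb R^n}p(\cdot)$, $p_+=\operatorname{ess\,sup}_{\mathbb R^n}p(\cdot)$. For an exponent function $p(\cdot)$ and a measurable function $f$ let $$\rho_{p(\cdot)}(f)=\int_{\{p(x)<\infty\}}|f(x)|^{p(x)}\,dx+\|f\|_{L^\infty(\{p(x)=\infty\})},\qquad \|f\|_{p(\cdot)}=\inf\{\lambda>0:\rho_{p(\cdot)}(f/\lambda)\le1\},$$ and let $L^{p(\cdot)}(\mathbb R^n)$ be the set of measurable $f$ with $\rho_{p(\cdot)}(f/\lambda)<\infty$ for some $\lambda>0$. Let $T_\alpha$ be a (real or complex) fractional Calderón–Zygmund operator with kernel $K_\alpha$. This means that $T_\alpha$ is bounded from $L^{r}(\mathbb R^n)$ to $L^{s}(\mathbb R^n)$ for some fixed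 $1<r\le s<\infty$; that for every $f\in L^r(\mathbb R^n)$ with compact support $$T_\alpha f(x)=\int_{\mathbb R^n}K_\alpha(x,y)f(y)\,dy\qquad\text{for almost every }x\notin\operatorname{supp} f;$$ and that for some constants $C_0$ and $\delta>0$, for all $x\ne y$, $$|K_\alpha(x,y)|\le\frac{C_0}{|x-y|^{n-\alpha}},$$ $$|K_\alpha(x+h,y)-K_\alpha(x,y)|+|K_\alpha(x,y+h)-K_\alpha(x,y)|\le C_0\frac{|h|^\delta}{|x-y|^{n-\alpha+\delta}}\quad\text{whenever }|h|<\tfrac12|x-y|.$$ Suppose that the kernel is non-degenerate: there are $a>0$ and a unit vector $u_1$ such that $$|K_\alpha(x,y)|\ge\frac{a}{|x-y|^{n-\alpha}}\qquad\text{whenever }x-y=tu_1,\ t\in\mathbb R\setminus\{0\}.$$ If $T_\alpha$ satisfies the strong inequality $T_\alpha:L^{p(\cdot)}(\mathbb R^n)\to L^{q(\cdot)}(\mathbb R^n)$, i.e. there is a constant $C$ such that $T_\alpha f\in L^{q(\cdot)}(\mathbb R^n)$ and $\|T_\alpha f\|_{q(\cdot)}\le C\|f\|_{p(\cdot)}$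 for all $f\in L^{p(\cdot)}(\mathbb R^n)$, then $$1<p_-\le p_+<\frac n\alpha,$$ where $n/\alpha=\infty$ if $\alpha=0$. -/

import Mathlib

open MeasureTheory
open scoped ENNReal NNReal

/-- Exponent functions on `ℝⁿ`: Lebesgue measurable functions with values in `[1, ∞]`. (For
such functions, `AEMeasurable` with respect to `volume` is Lebesgue measurability.) -/
structure IsExponent {n : ℕ} (p : EuclideanSpace ℝ (Fin n) → ℝ≥0∞) : Prop where
  measurable : AEMeasurable p volume
  one_le : ∀ x, 1 ≤ p x

/-- The modular `∫_{p < ∞} |f(x)|^{p(x)} dx + ‖f‖_{L^∞({p = ∞})}`. -/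
noncomputable def varModular {𝕜 : Type*} [RCLike 𝕜] {n : ℕ}
    (p : EuclideanSpace ℝ (Fin n) → ℝ≥0∞) (f : EuclideanSpace ℝ (Fin n) → 𝕜) : ℝ≥0∞ :=
  (∫⁻ x in {x | p x ≠ ∞}, ‖f x‖ₑ ^ (p x).toReal) +
    eLpNorm f ∞ (volume.restrict {x | p x = ∞})

/-- Membership in the variable Lebesgue space `L^{p(·)}(ℝⁿ)`. -/
def MemVarLp {𝕜 : Type*} [RCLike 𝕜] {n : ℕ}
    (p : EuclideanSpace ℝ (Fin n) → ℝ≥0∞) (f : EuclideanSpace ℝ (Fin n) → 𝕜) : Prop :=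
  AEStronglyMeasurable f volume ∧ ∃ l : ℝ, 0 < l ∧ varModular p (l⁻¹ • f) < ∞

/-- The Luxemburg norm `inf {l > 0 : ρ(f / l) ≤ 1}` of `L^{p(·)}(ℝⁿ)`, as an extended
nonnegative real (the infimum of the empty set is `∞`). -/
noncomputable def varNorm {𝕜 : Type*} [RCLike 𝕜] {n : ℕ}
    (p : EuclideanSpace ℝ (Fin n) → ℝ≥0∞) (f : EuclideanSpace ℝ (Fin n) → 𝕜) : ℝ≥0∞ :=
  ⨅ (l : ℝ) (_ : 0 < l) (_ : varModular p (l⁻¹ • f) ≤ 1), ENNReal.ofReal l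

/-- The strong `(p(·), q(·))` inequality: `T` maps `L^{p(·)}` into `L^{q(·)}` and
`‖T f‖_{q(·)} ≤ C ‖f‖_{p(·)}` for a constant `C` independent of `f`. -/
def StrongType {𝕜 : Type*} [RCLike 𝕜] {n : ℕ} (p q : EuclideanSpace ℝ (Fin n) → ℝ≥0∞)
    (T : (EuclideanSpace ℝ (Fin n) → 𝕜) → (EuclideanSpace ℝ (Fin n) → 𝕜)) : Prop :=
  ∃ C : ℝ≥0, ∀ f, MemVarLp p f → MemVarLp q (T f) ∧ varNorm q (T f) ≤ C * varNorm p f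

/-- Size and smoothness estimates for a kernel `K(x, y)`, `x ≠ y`, of fractional order `α`. The
values of `K` on the diagonal play no role. -/
def IsFractionalKernel {𝕜 : Type*} [RCLike 𝕜] {n : ℕ} (α : ℝ)
    (K : EuclideanSpace ℝ (Fin n) → EuclideanSpace ℝ (Fin n) → 𝕜) : Prop :=
  ∃ C₀ δ : ℝ, 0 < δ ∧
    (∀ x y, x ≠ y → ‖K x y‖ ≤ C₀ / ‖x - y‖ ^ ((n : ℝ) - α)) ∧
    (∀ x y h, x ≠ y → ‖h‖ < 1 / 2 * ‖x - y‖ →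
      ‖K (x + h) y - K x y‖ + ‖K x (y + h) - K x y‖ ≤
        C₀ * (‖h‖ ^ δ / ‖x - y‖ ^ ((n : ℝ) - α + δ)))

/-- `T` is a fractional Calderón–Zygmund operator of order `α` with kernel `K`: it is bounded from
`L^r` to `L^s` for some fixed `1 < r ≤ s < ∞`, and for compactly supported `f ∈ L^r` it is given by
integration against `K` off the support of `f`. Linearity of `T` is not required, so all linear
operators of this kind are included; values of `T` outside the spaces in question are immaterial. -/
def IsFractionalCZO {𝕜 : Type*} [RCLike 𝕜] {n : ℕ} (α : ℝ)
    (K : EuclideanSpace ℝ (Fin n) → EuclideanSpace ℝ (Fin n) → 𝕜)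
    (T : (EuclideanSpace ℝ (Fin n) → 𝕜) → (EuclideanSpace ℝ (Fin n) → 𝕜)) : Prop :=
  IsFractionalKernel α K ∧
  ∃ r s : ℝ≥0∞, 1 < r ∧ r ≤ s ∧ s < ∞ ∧
    (∃ C : ℝ≥0, ∀ f, MemLp f r volume →
      MemLp (T f) s volume ∧ eLpNorm (T f) s volume ≤ C * eLpNorm f r volume) ∧
    (∀ f, MemLp f r volume → HasCompactSupport f →
      ∀ᵐ x, x ∉ tsupport f → T f x = ∫ y, K x y * f y)

/-- The kernel is non-degenerate (in one direction `u`). -/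
def IsNondegenerateKernel {𝕜 : Type*} [RCLike 𝕜] {n : ℕ} (α : ℝ)
    (K : EuclideanSpace ℝ (Fin n) → EuclideanSpace ℝ (Fin n) → 𝕜) : Prop :=
  ∃ (a : ℝ) (u : EuclideanSpace ℝ (Fin n)), 0 < a ∧ ‖u‖ = 1 ∧
    ∀ (x y : EuclideanSpace ℝ (Fin n)) (t : ℝ), t ≠ 0 → x - y = t • u →
      a / ‖x - y‖ ^ ((n : ℝ) - α) ≤ ‖K x y‖

/-! Both strict bounds are proved by contradiction, testing `T` on a geometric chain of balls. Let
`E` be a set of positive measure where the exponent is nearly extremal. Around a density point of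
`E`, take balls centred at distance `d_i` from it in the direction `u`, with radius `σ d_i` and
`d_i` of ratio `σ / 2`, each at least half filled by `E`; let `S_i` be the part of `E` in the `i`-th
ball. Seen from the `i`-th ball, all later balls look like the density point, so by
`IsFractionalKernel.exists_phase` the kernel between balls `i < l` has size at least a multiple of
`d_i ^ (α - n)` and an almost constant phase.

Group the indices into blocks of `k`. The `k` terms of one block add up without cancellation on the
neighbouring block, so the boundedness of `T` gains a factor `1 / k`
(`varNorm_stepFun_le_of_phase`). Returning from `q` to `p` by Hölder costs only `k ^ (α / n)`
(`varNorm_stepFun_le`). As `α < n`, the factor `ε` per block is as small as desired for large `k`.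

Near `p = 1`, test on the sums of `d_i ^ (-n) χ_{S_i}`: the norm on a block is at most `ε` times the
norm on the next one. If `p ≤ 1 + 1 / (k n)` on `E`, these norms grow at most like `(2 / σ) ^ j`, a
rate independent of `k`. With `ε < σ / 2` the first norm vanishes, which is absurd. Near `q = ∞`,
the sums of `χ_{S_i}` shrink by `ε` from each block to the next, while `q ≥ k n` on `E` keeps them
above a multiple of `(σ / 2) ^ j`. So `q` is essentially bounded, and the relation between the
exponents turns this into the bound on `p`. -/

/-- Young's inequality for the Hölder triple `1 / P = 1 / Q + β`. -/
lemma ENNReal.mul_rpow_rpow_le_add {P Q β : ℝ} (hP : 0 < P) (hQ : 0 < Q) (hβ : 0 ≤ β)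
    (h : P⁻¹ = Q⁻¹ + β) (t s : ℝ≥0∞) : (t * s ^ β) ^ P ≤ t ^ Q + s := by
  rcases eq_or_ne t ∞ with rfl | ht
  · simp [ENNReal.top_rpow_of_pos hQ]
  rcases eq_or_ne s ∞ with rfl | hs
  · simp
  lift t to ℝ≥0 using ht
  lift s to ℝ≥0 using hs
  have hw : P / Q + P * β = 1 := by
    have := congrArg (P * ·) h
    simp only [mul_inv_cancel₀ hP.ne', mul_add] at this
    rw [div_eq_mul_inv]; exact this.symm
  have h1 : 0 ≤ P / Q := by positivity
  have h2 : 0 ≤ P * β := by positivity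
  have key := NNReal.geom_mean_le_arith_mean2_weighted ⟨P / Q, h1⟩ ⟨P * β, h2⟩ (t ^ Q) s
    (NNReal.eq hw)
  have e : (t * s ^ β) ^ P = (t ^ Q) ^ (P / Q) * s ^ (P * β) := by
    rw [NNReal.mul_rpow, ← NNReal.rpow_mul, ← NNReal.rpow_mul, mul_div_cancel₀ _ hQ.ne',
      mul_comm β P]
  have l1 : (⟨P / Q, h1⟩ : ℝ≥0) ≤ 1 := show P / Q ≤ 1 by linarith
  have l2 : (⟨P * β, h2⟩ : ℝ≥0) ≤ 1 := show P * β ≤ 1 by linarith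
  have : (t * s ^ β) ^ P ≤ t ^ Q + s := by
    rw [e]
    refine key.trans (add_le_add ?_ ?_)
    · exact mul_le_of_le_one_left' l1
    · exact mul_le_of_le_one_left' l2
  rw [← ENNReal.coe_rpow_of_nonneg _ hβ, ← ENNReal.coe_mul, ← ENNReal.coe_rpow_of_nonneg _ hP.le,
    ← ENNReal.coe_rpow_of_nonneg _ hQ.le, ← ENNReal.coe_add]
  exact_mod_cast this

/-! ### Modulars, Luxemburg norms and Hölder's inequality -/

section

variable {𝕜 : Type*} [RCLike 𝕜] {n : ℕ} {p q : EuclideanSpace ℝ (Fin n) → ℝ≥0∞}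
  {f g : EuclideanSpace ℝ (Fin n) → 𝕜}

lemma IsExponent.one_le_toReal (hp : IsExponent p) {x : EuclideanSpace ℝ (Fin n)}
    (hx : p x ≠ ∞) : 1 ≤ (p x).toReal := by
  simpa using ENNReal.toReal_mono hx (hp.one_le x)

lemma IsExponent.nullMeasurableSet_ne_top (hp : IsExponent p) :
    NullMeasurableSet {x | p x ≠ ∞} :=
  hp.measurable.nullMeasurable (measurableSet_singleton (∞ : ℝ≥0∞)).compl

lemma IsExponent.nullMeasurableSet_eq_top (hp : IsExponent p) :
    NullMeasurableSet {x | p x = ∞} :=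
  hp.measurable.nullMeasurable (measurableSet_singleton (∞ : ℝ≥0∞))

lemma varModular_mono (h : ∀ᵐ x, ‖f x‖ₑ ≤ ‖g x‖ₑ) : varModular p f ≤ varModular p g := by
  refine add_le_add (lintegral_mono_ae (ae_restrict_of_ae ?_)) ?_
  · filter_upwards [h] with x hx using ENNReal.rpow_le_rpow hx ENNReal.toReal_nonneg
  · exact eLpNormEssSup_mono_enorm_ae (ae_restrict_of_ae h)

lemma enorm_inv_smul {l : ℝ} (hl : 0 < l) (z : 𝕜) : ‖l⁻¹ • z‖ₑ = (ENNReal.ofReal l)⁻¹ * ‖z‖ₑ := by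
  rw [enorm_smul, Real.enorm_eq_ofReal (by positivity), ENNReal.ofReal_inv_of_pos hl]

lemma varNorm_le_of_varModular_le {l : ℝ} (hl : 0 < l) (h : varModular p (l⁻¹ • f) ≤ 1) :
    varNorm p f ≤ ENNReal.ofReal l :=
  iInf_le_of_le l (iInf_le_of_le hl (iInf_le _ h))

lemma varNorm_le_mul {c : ℝ} (hc : 0 < c) (h : ∀ᵐ x, ‖f x‖ₑ ≤ ENNReal.ofReal c * ‖g x‖ₑ) :
    varNorm p f ≤ ENNReal.ofReal c * varNorm p g := by
  have hc0 : ENNReal.ofReal c ≠ 0 := by simpa using hc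
  unfold varNorm
  simp_rw [ENNReal.mul_iInf_of_ne hc0 ENNReal.ofReal_ne_top]
  refine le_iInf fun l => le_iInf fun hl => le_iInf fun hm => ?_
  rw [← ENNReal.ofReal_mul hc.le]
  refine varNorm_le_of_varModular_le (by positivity) ((varModular_mono ?_).trans hm)
  filter_upwards [h] with x hx
  rw [Pi.smul_apply, Pi.smul_apply, enorm_inv_smul (by positivity), enorm_inv_smul hl,
    ENNReal.ofReal_mul hc.le, ENNReal.mul_inv (by simp [hc]) (by simp)]
  calc _ ≤ (ENNReal.ofReal c)⁻¹ * (ENNReal.ofReal l)⁻¹ * (ENNReal.ofReal c * ‖g x‖ₑ) := by gcongr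
    _ = ((ENNReal.ofReal c)⁻¹ * ENNReal.ofReal c) * ((ENNReal.ofReal l)⁻¹ * ‖g x‖ₑ) := by ring
    _ = _ := by rw [ENNReal.inv_mul_cancel hc0 ENNReal.ofReal_ne_top, one_mul]

/-- Since `p ≥ 1`, a factor `1 / l ≤ 1` raised to the power `p(x)` is at most `1 / l`; the supremum
part is homogeneous. -/
lemma varModular_inv_smul_le (hp : IsExponent p) {l : ℝ} (hl : 1 ≤ l) :
    varModular p (l⁻¹ • f) ≤ (ENNReal.ofReal l)⁻¹ * varModular p f := by
  have hl0 : 0 < l := by linarith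
  have hle : (ENNReal.ofReal l)⁻¹ ≤ 1 := by simpa using hl
  unfold varModular
  rw [mul_add]
  refine add_le_add ?_ ?_
  · rw [← lintegral_const_mul' _ _ (by simpa using hl0)]
    refine lintegral_mono_ae ?_
    filter_upwards [ae_restrict_mem₀ hp.nullMeasurableSet_ne_top] with x hx
    have h1 := hp.one_le_toReal hx
    rw [Pi.smul_apply, enorm_inv_smul hl0, ENNReal.mul_rpow_of_nonneg _ _ (by linarith)]
    gcongr
    exact (ENNReal.rpow_le_rpow_of_exponent_ge hle h1).trans_eq (ENNReal.rpow_one _)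
  · rw [eLpNorm_const_smul, Real.enorm_eq_ofReal (by positivity), ENNReal.ofReal_inv_of_pos hl0]

/-- Dividing by `max 1 ρ(f)` already brings the modular down to at most one. This bounds norms even
where the exponent is unbounded. -/
lemma varNorm_le_max_one (hp : IsExponent p) : varNorm p f ≤ max 1 (varModular p f) := by
  rcases eq_or_ne (varModular p f) ∞ with h | h
  · simp [h]
  set l : ℝ := max 1 (varModular p f).toReal
  have hl : 1 ≤ l := le_max_left _ _
  have e : ENNReal.ofReal l = max 1 (varModular p f) := by
    rw [ENNReal.ofReal_max, ENNReal.ofReal_toReal h, ENNReal.ofReal_one]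
  rw [← e]
  refine varNorm_le_of_varModular_le (by linarith) ((varModular_inv_smul_le hp hl).trans ?_)
  rw [mul_comm, ← div_eq_mul_inv]
  refine ENNReal.div_le_of_le_mul ?_
  rw [one_mul, e]
  exact le_max_right _ _

/-- Hölder's inequality with a weight in `L^{1 / β}`. -/
lemma varNorm_le_two_mul_of_holder (hp : IsExponent p) (hq : IsExponent q) {β : ℝ} (hβ : 0 ≤ β)
    (hpq : ∀ᵐ x, (p x)⁻¹ = (q x)⁻¹ + ENNReal.ofReal β)
    {ψ : EuclideanSpace ℝ (Fin n) → ℝ≥0∞} (hψ : Measurable ψ) (hψ1 : ∫⁻ x, ψ x ≤ 1)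
    (h : ∀ᵐ x, ‖g x‖ₑ ≤ ‖f x‖ₑ * ψ x ^ β) : varNorm p g ≤ 2 * varNorm q f := by
  conv_rhs => unfold varNorm
  simp_rw [ENNReal.mul_iInf_of_ne (two_ne_zero) (ENNReal.ofNat_ne_top)]
  refine le_iInf fun l => le_iInf fun hl => le_iInf fun hm => ?_
  have h2 : (2 : ℝ≥0∞) * ENNReal.ofReal l = ENNReal.ofReal (2 * l) := by
    rw [ENNReal.ofReal_mul (by norm_num)]; simp
  rw [h2]
  refine varNorm_le_of_varModular_le (by linarith) ?_
  set F : EuclideanSpace ℝ (Fin n) → 𝕜 := l⁻¹ • f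
  set G : EuclideanSpace ℝ (Fin n) → 𝕜 := l⁻¹ • g
  have hG : ∀ᵐ x, ‖G x‖ₑ ≤ ‖F x‖ₑ * ψ x ^ β := by
    filter_upwards [h] with x hx
    simp only [F, G, Pi.smul_apply]
    rw [enorm_inv_smul hl, enorm_inv_smul hl, mul_assoc]
    gcongr
  have e : (2 * l)⁻¹ • g = (2 : ℝ)⁻¹ • G := by
    rw [smul_smul, mul_inv]
  rw [e]
  refine (varModular_inv_smul_le hp one_le_two).trans ?_
  suffices hs : varModular p G ≤ varModular q F + 1 by
    calc _ ≤ (ENNReal.ofReal 2)⁻¹ * (1 + 1) := by gcongr; exact hs.trans (by gcongr)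
      _ = 1 := by
        rw [one_add_one_eq_two, ENNReal.ofReal_ofNat]
        exact ENNReal.inv_mul_cancel two_ne_zero ENNReal.ofNat_ne_top
  have hF1 : ∀ᵐ x, q x = ∞ → ‖F x‖ₑ ≤ 1 := by
    have h1 : eLpNorm F ∞ (volume.restrict {x | q x = ∞}) ≤ 1 := le_add_self.trans hm
    rw [eLpNorm_exponent_top] at h1
    have := (ae_restrict_iff'₀ hq.nullMeasurableSet_eq_top).1
      (ae_le_eLpNormEssSup (f := F) (μ := volume.restrict {x | q x = ∞}))
    filter_upwards [this] with x hx hqx using (hx hqx).trans h1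
  have hint : ∫⁻ x in {x | p x ≠ ∞}, ‖G x‖ₑ ^ (p x).toReal ≤
      (∫⁻ x in {x | q x ≠ ∞}, ‖F x‖ₑ ^ (q x).toReal) + 1 := by
    rw [← lintegral_indicator₀ hp.nullMeasurableSet_ne_top,
      ← lintegral_indicator₀ hq.nullMeasurableSet_ne_top]
    refine le_trans ?_ (add_le_add_right hψ1 _)
    rw [← lintegral_add_right _ hψ]
    refine lintegral_mono_ae ?_
    filter_upwards [hG, hF1, hpq] with x hx h1 hpqx
    by_cases hpx : p x = ∞
    · simp [hpx]
    have hP := hp.one_le_toReal hpx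
    rw [Set.indicator_of_mem (by exact hpx)]
    have hpos : 0 < (p x).toReal := by linarith
    refine (ENNReal.rpow_le_rpow hx hpos.le).trans ?_
    -- Where `q = ∞`, `|F| ≤ 1` and `β p(x) = 1`, so the weight alone remains; elsewhere Young's
    -- inequality splits the product.
    by_cases hqx : q x = ∞
    · rw [Set.indicator_of_notMem (by simpa using hqx), zero_add]
      have hβp : β * (p x).toReal = 1 := by
        rw [hqx, ENNReal.inv_top, zero_add] at hpqx
        have := congrArg ENNReal.toReal hpqx
        rw [ENNReal.toReal_inv, ENNReal.toReal_ofReal hβ] at this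
        rw [← this, inv_mul_cancel₀ hpos.ne']
      calc _ ≤ (1 * ψ x ^ β) ^ (p x).toReal :=
            ENNReal.rpow_le_rpow (by gcongr; exact h1 hqx) hpos.le
        _ = ψ x := by rw [one_mul, ← ENNReal.rpow_mul, hβp, ENNReal.rpow_one]
    · rw [Set.indicator_of_mem (by exact hqx)]
      have hQ := hq.one_le_toReal hqx
      refine ENNReal.mul_rpow_rpow_le_add hpos (by linarith) hβ ?_ _ _
      have := congrArg ENNReal.toReal hpqx
      have hq0 : q x ≠ 0 := (zero_lt_one.trans_le (hq.one_le x)).ne'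
      rwa [ENNReal.toReal_add (by simpa using hq0) ENNReal.ofReal_ne_top, ENNReal.toReal_inv,
        ENNReal.toReal_inv, ENNReal.toReal_ofReal hβ] at this
  have hsup : eLpNorm G ∞ (volume.restrict {x | p x = ∞}) ≤
      eLpNorm F ∞ (volume.restrict {x | q x = ∞}) := by
    by_cases h0 : ∀ᵐ x, p x ≠ ∞
    · have : volume {x | p x = ∞} = 0 := by simpa [ae_iff] using h0
      rw [Measure.restrict_eq_zero.2 this]; simp
    -- At a point with `p = ∞` the exponent relation forces `β = 0`; then `p = q` almost everywhere
    -- and the weight is trivial.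
    have hβ0 : β = 0 := by
      by_contra hne
      refine h0 ?_
      filter_upwards [hpq] with x hx hpx
      rw [hpx, ENNReal.inv_top] at hx
      have := (add_eq_zero.1 hx.symm).2
      rw [ENNReal.ofReal_eq_zero] at this
      exact hne (le_antisymm this hβ)
    have hset : {x | p x = ∞} =ᵐ[volume] {x | q x = ∞} := by
      filter_upwards [hpq] with x hx
      rw [hβ0, ENNReal.ofReal_zero, add_zero, inv_inj] at hx
      exact propext (by show p x = ∞ ↔ q x = ∞; rw [hx])
    rw [Measure.restrict_congr_set hset]
    refine eLpNormEssSup_mono_enorm_ae (ae_restrict_of_ae ?_)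
    filter_upwards [hG] with x hx
    simpa [hβ0] using hx
  calc varModular p G ≤ ((∫⁻ x in {x | q x ≠ ∞}, ‖F x‖ₑ ^ (q x).toReal) + 1) +
        eLpNorm F ∞ (volume.restrict {x | q x = ∞}) := add_le_add hint hsup
    _ = varModular q F + 1 := by unfold varModular; ring

lemma varModular_le_of_le_indicator (hp : IsExponent p) {S : Set (EuclideanSpace ℝ (Fin n))}
    (hS : MeasurableSet S) (h : ∀ x, ‖f x‖ₑ ≤ S.indicator 1 x) :
    varModular p f ≤ volume S + 1 := by
  refine add_le_add ?_ ?_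
  · refine (lintegral_mono_ae (g := S.indicator 1) ?_).trans ?_
    · filter_upwards [ae_restrict_mem₀ hp.nullMeasurableSet_ne_top] with x hx
      have hP := hp.one_le_toReal hx
      refine (ENNReal.rpow_le_rpow (h x) (by linarith)).trans ?_
      by_cases hxS : x ∈ S
      · simp [hxS]
      · simp [hxS, ENNReal.zero_rpow_of_pos (show 0 < (p x).toReal by linarith)]
    · rw [lintegral_indicator_one hS]
      exact Measure.restrict_apply_le _ _
  · rw [eLpNorm_exponent_top]
    refine eLpNormEssSup_le_of_ae_enorm_bound (Filter.Eventually.of_forall fun x => (h x).trans ?_)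
    exact Set.indicator_le_self' (fun _ _ => zero_le) x

lemma memVarLp_of_bounded (hp : IsExponent p) (hf : AEStronglyMeasurable f volume)
    {S : Set (EuclideanSpace ℝ (Fin n))} (hS : MeasurableSet S) (hSfin : volume S ≠ ∞) {M : ℝ}
    (hM : ∀ x, ‖f x‖ ≤ M) (h0 : ∀ x ∉ S, f x = 0) : MemVarLp p f := by
  refine ⟨hf, max M 1, by positivity, ?_⟩
  have hl : 0 < max M 1 := by positivity
  refine (varModular_le_of_le_indicator hp hS fun x => ?_).trans_lt
    (ENNReal.add_lt_top.2 ⟨hSfin.lt_top, ENNReal.one_lt_top⟩)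
  by_cases hx : x ∈ S
  · rw [Set.indicator_of_mem hx, Pi.smul_apply, Pi.one_apply, ← ofReal_norm, norm_smul,
      ENNReal.ofReal_le_one, Real.norm_of_nonneg (by positivity), inv_mul_le_one₀ hl]
    exact (hM x).trans (le_max_left _ _)
  · simp [h0 x hx]

/-- Upper bound for the modular of a bounded function living where the exponent is at most `P`. -/
lemma varModular_le_of_exponent_le {P : ℝ} {S : Set (EuclideanSpace ℝ (Fin n))}
    (hS : MeasurableSet S) (hp : IsExponent p) (hP : ∀ x ∈ S, p x ≤ ENNReal.ofReal P) {M : ℝ}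
    (hM1 : 1 ≤ M) (hM : ∀ x, ‖f x‖ ≤ M) (h0 : ∀ x ∉ S, f x = 0) :
    varModular p f ≤ ENNReal.ofReal (M ^ P) * volume S := by
  have hfin : ∀ x ∈ S, p x ≠ ∞ := fun x hx => ((hP x hx).trans_lt ENNReal.ofReal_lt_top).ne
  have h2 : eLpNorm f ∞ (volume.restrict {x | p x = ∞}) = 0 := by
    rw [eLpNorm_exponent_top]
    refine le_antisymm (eLpNormEssSup_le_of_ae_enorm_bound ?_) (zero_le)
    filter_upwards [ae_restrict_mem₀ hp.nullMeasurableSet_eq_top] with x hx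
    rw [h0 x fun hxS => hfin x hxS hx, enorm_zero]
  unfold varModular
  rw [h2, add_zero]
  refine (lintegral_mono_ae (g := S.indicator fun _ => ENNReal.ofReal (M ^ P)) ?_).trans ?_
  · filter_upwards [ae_restrict_mem₀ hp.nullMeasurableSet_ne_top] with x hx
    have hx1 := hp.one_le_toReal hx
    by_cases hxS : x ∈ S
    · rw [Set.indicator_of_mem hxS, ← ENNReal.ofReal_rpow_of_pos (by linarith)]
      have hP0 : 1 ≤ P := by
        have := (hp.one_le x).trans (hP x hxS)
        simpa using this
      calc _ ≤ ENNReal.ofReal M ^ (p x).toReal := by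
            refine ENNReal.rpow_le_rpow ?_ (by linarith)
            rw [← ofReal_norm]
            exact ENNReal.ofReal_le_ofReal (hM x)
        _ ≤ _ := by
            refine ENNReal.rpow_le_rpow_of_exponent_le (by simpa using hM1) ?_
            exact ENNReal.toReal_le_of_le_ofReal (by linarith) (hP x hxS)
    · rw [h0 x hxS]
      simp [ENNReal.zero_rpow_of_pos (show 0 < (p x).toReal by linarith)]
  · rw [lintegral_indicator_const hS]
    gcongr
    exact Measure.restrict_le_self

/-- Lower bound for the norm of a function that is large where the exponent is at least `Q`. -/
lemma le_varNorm_of_le_exponent {Q : ℝ} (hQ : 1 ≤ Q) (hq : IsExponent q)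
    {S : Set (EuclideanSpace ℝ (Fin n))} (hS : MeasurableSet S)
    (hSQ : ∀ x ∈ S, ENNReal.ofReal Q ≤ q x) {w m : ℝ} (hw : 0 < w) (hm0 : 0 < m) (hm1 : m ≤ 1)
    (hmS : ENNReal.ofReal m ≤ volume S) (hf : ∀ x ∈ S, w ≤ ‖f x‖) :
    ENNReal.ofReal (w * m ^ Q⁻¹) ≤ varNorm q f := by
  refine le_iInf fun l => le_iInf fun hl => le_iInf fun hle => ?_
  refine ENNReal.ofReal_le_ofReal ?_
  -- For such an `l`, the modular of `f / l` is at least `(w / l) ^ Q * m > 1`. The condition `m ≤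
  -- 1` ensures `w / l > 1`, so raising the exponent from `Q` to `q(x)` only helps.
  by_contra! hlt
  have hmQ : m ^ Q⁻¹ ≤ 1 := Real.rpow_le_one hm0.le hm1 (by positivity)
  have hlw : l < w := hlt.trans_le (mul_le_of_le_one_right hw.le hmQ)
  have hr : 1 < l⁻¹ * w := by rwa [inv_mul_eq_div, one_lt_div hl]
  have hnorm : ∀ x ∈ S, ENNReal.ofReal (l⁻¹ * w) ≤ ‖(l⁻¹ • f) x‖ₑ := by
    intro x hx
    rw [← ofReal_norm]
    refine ENNReal.ofReal_le_ofReal ?_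
    rw [Pi.smul_apply, norm_smul, Real.norm_of_nonneg (by positivity)]
    gcongr
    exact hf x hx
  -- On `{q = ∞}` the modular bound gives `|f / l| ≤ 1`, whereas `|f / l| > 1` on `S`.
  have hfin : ∀ᵐ x, x ∈ S → q x ≠ ∞ := by
    have h1 : eLpNorm (l⁻¹ • f) ∞ (volume.restrict {x | q x = ∞}) ≤ 1 := le_add_self.trans hle
    rw [eLpNorm_exponent_top] at h1
    have := (ae_restrict_iff'₀ hq.nullMeasurableSet_eq_top).1
      (ae_le_eLpNormEssSup (f := l⁻¹ • f) (μ := volume.restrict {x | q x = ∞}))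
    filter_upwards [this] with x hx hxS hqx
    have := (hnorm x hxS).trans ((hx hqx).trans h1)
    rw [ENNReal.ofReal_le_one] at this
    linarith
  have hlow : ENNReal.ofReal ((l⁻¹ * w) ^ Q) * volume S ≤ 1 := by
    refine le_trans ?_ (le_self_add.trans hle)
    rw [← lintegral_indicator_const hS, ← lintegral_indicator₀ hq.nullMeasurableSet_ne_top]
    refine lintegral_mono_ae ?_
    filter_upwards [hfin] with x hx
    by_cases hxS : x ∈ S
    · rw [Set.indicator_of_mem hxS, Set.indicator_of_mem (by exact hx hxS),
        ← ENNReal.ofReal_rpow_of_pos (by positivity)]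
      calc _ ≤ ENNReal.ofReal (l⁻¹ * w) ^ (q x).toReal := by
            refine ENNReal.rpow_le_rpow_of_exponent_le (by simpa using hr.le) ?_
            exact (ENNReal.ofReal_le_iff_le_toReal (hx hxS)).1 (hSQ x hxS)
        _ ≤ _ := ENNReal.rpow_le_rpow (hnorm x hxS) ENNReal.toReal_nonneg
    · simp [hxS]
  have h3 : (l⁻¹ * w) ^ Q * m ≤ 1 := by
    have : ENNReal.ofReal ((l⁻¹ * w) ^ Q * m) ≤ 1 := by
      rw [ENNReal.ofReal_mul (by positivity)]
      exact le_trans (by gcongr) hlow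
    simpa using this
  have h4 : 1 < (l⁻¹ * w) * m ^ Q⁻¹ := by
    rwa [mul_assoc, inv_mul_eq_div, one_lt_div hl]
  have h5 : 1 < ((l⁻¹ * w) * m ^ Q⁻¹) ^ Q := Real.one_lt_rpow h4 (by linarith)
  rw [Real.mul_rpow (by positivity) (by positivity), ← Real.rpow_mul hm0.le,
    inv_mul_cancel₀ (by linarith), Real.rpow_one] at h5
  linarith

end

/-! ### Step functions on disjoint sets -/

/-- The function `∑_{i ∈ J} w_i χ_{S_i}`. -/
noncomputable def stepFun {X γ : Type*} [AddCommMonoid γ] (J : Finset ℕ) (S : ℕ → Set X) (w : ℕ → γ) (x : X) :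
    γ :=
  ∑ i ∈ J, (S i).indicator (fun _ => w i) x

section

variable {X γ : Type*} [AddCommMonoid γ] {J : Finset ℕ} {S : ℕ → Set X} {w : ℕ → γ}

lemma stepFun_of_mem (hS : Pairwise (Function.onFun Disjoint S)) {i : ℕ} (hi : i ∈ J) {x : X}
    (hx : x ∈ S i) : stepFun J S w x = w i := by
  unfold stepFun
  rw [Finset.sum_eq_single_of_mem i hi fun l _ hl => Set.indicator_of_notMem
    (fun hxl => Set.disjoint_left.1 (hS hl) hxl hx) _, Set.indicator_of_mem hx]

lemma stepFun_of_notMem {x : X} (hx : ∀ i ∈ J, x ∉ S i) : stepFun J S w x = 0 :=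
  Finset.sum_eq_zero fun i hi => Set.indicator_of_notMem (hx i hi) _

lemma measurable_stepFun [MeasurableSpace X] [MeasurableSpace γ] [MeasurableAdd₂ γ]
    (hS : ∀ i, MeasurableSet (S i)) : Measurable (stepFun J S w) :=
  Finset.measurable_fun_sum _ fun i _ => measurable_const.indicator (hS i)

end

/-! ### Kernel estimates and density points -/

section

variable {𝕜 : Type*} [RCLike 𝕜] {n : ℕ} {α : ℝ}
  {K : EuclideanSpace ℝ (Fin n) → EuclideanSpace ℝ (Fin n) → 𝕜}

lemma stepFun_norm_le {X : Type*} {J : Finset ℕ} {S : ℕ → Set X} {w : ℕ → 𝕜}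
    (hS : Pairwise (Function.onFun Disjoint S)) {M : ℝ} (hM0 : 0 ≤ M) (hM : ∀ i ∈ J, ‖w i‖ ≤ M)
    (x : X) : ‖stepFun J S w x‖ ≤ M := by
  by_cases hx : ∃ i ∈ J, x ∈ S i
  · obtain ⟨i, hi, hxi⟩ := hx
    rw [stepFun_of_mem hS hi hxi]
    exact hM i hi
  · push Not at hx
    rw [stepFun_of_notMem hx, norm_zero]
    exact hM0

/-- The Hölder estimate in the second variable gives continuity off the diagonal, hence
integrability of the kernel over compact sets avoiding `x`. -/
lemma IsFractionalKernel.continuousOn (hker : IsFractionalKernel α K)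
    (x : EuclideanSpace ℝ (Fin n)) : ContinuousOn (K x) {x}ᶜ := by
  obtain ⟨C₀, δ, hδ, -, hsm⟩ := hker
  intro y hy
  refine ContinuousAt.continuousWithinAt ?_
  have hxy : x ≠ y := fun h => hy h.symm
  have hpos : 0 < ‖x - y‖ := norm_pos_iff.2 (sub_ne_zero.2 hxy)
  rw [ContinuousAt, tendsto_iff_norm_sub_tendsto_zero]
  refine squeeze_zero' (Filter.Eventually.of_forall fun _ => norm_nonneg _)
    (g := fun z => C₀ * (‖z - y‖ ^ δ / ‖x - y‖ ^ ((n : ℝ) - α + δ))) ?_ ?_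
  · filter_upwards [Metric.ball_mem_nhds y (half_pos hpos)] with z hz
    rw [mem_ball_iff_norm] at hz
    have := hsm x y (z - y) hxy (by linarith)
    rw [add_sub_cancel] at this
    linarith [norm_nonneg (K (x + (z - y)) y - K x y)]
  · have : Continuous fun z => C₀ * (‖z - y‖ ^ δ / ‖x - y‖ ^ ((n : ℝ) - α + δ)) :=
      continuous_const.mul (Continuous.div_const
        ((continuous_id.sub continuous_const).norm.rpow_const fun _ => Or.inr hδ.le) _)
    have h := this.tendsto y
    simpa [Real.zero_rpow hδ.ne'] using h

/-- On pairs close to `(X, Y)` with `X - Y` in the nondegenerate direction, the kernel is, up to a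
phase, bounded below. -/
lemma IsFractionalKernel.exists_phase (hαn : α < n) (hker : IsFractionalKernel α K) {a : ℝ}
    {u : EuclideanSpace ℝ (Fin n)} (ha : 0 < a) (hu : ‖u‖ = 1)
    (hnd : ∀ (x y : EuclideanSpace ℝ (Fin n)) (t : ℝ), t ≠ 0 → x - y = t • u →
      a / ‖x - y‖ ^ ((n : ℝ) - α) ≤ ‖K x y‖) :
    ∃ σ : ℝ, 0 < σ ∧ σ < 1 / 8 ∧ ∀ (X Y : EuclideanSpace ℝ (Fin n)) (t : ℝ), t ≠ 0 →
      X - Y = t • u → ∃ θ : 𝕜, ‖θ‖ = 1 ∧ ∀ x y, ‖x - X‖ ≤ σ * |t| → ‖y - Y‖ ≤ σ * |t| →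
        a / 2 / |t| ^ ((n : ℝ) - α) ≤ RCLike.re (θ * K x y) := by
  obtain ⟨C₀, δ, hδ, -, hsm⟩ := hker
  set d : ℝ := (n : ℝ) - α
  have hd : 0 < d := sub_pos.2 hαn
  set D : ℝ := 2 * (|C₀| * 2 ^ (d + δ))
  -- Moving both variables by `σ |t|` changes the kernel by at most `D σ ^ δ / |t| ^ (n - α)`; this
  -- is to use up only half of the nondegeneracy bound.
  obtain ⟨σ, hσ0, hσ8, hσD⟩ : ∃ σ : ℝ, 0 < σ ∧ σ < 1 / 8 ∧ D * σ ^ δ ≤ a / 2 := by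
    have hc : Filter.Tendsto (fun s : ℝ => D * s ^ δ) (nhdsWithin 0 (Set.Ioi 0)) (nhds 0) := by
      have : Continuous fun s : ℝ => D * s ^ δ :=
        continuous_const.mul (continuous_id.rpow_const fun _ => Or.inr hδ.le)
      have h := this.tendsto 0
      rw [Real.zero_rpow hδ.ne', mul_zero] at h
      exact h.mono_left nhdsWithin_le_nhds
    have h1 := hc.eventually (Iio_mem_nhds (half_pos ha))
    have h2 : Set.Ioo (0 : ℝ) (1 / 8) ∈ nhdsWithin (0 : ℝ) (Set.Ioi 0) :=
      Ioo_mem_nhdsGT (by norm_num)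
    obtain ⟨s, hs, hs'⟩ := (h1.and h2).exists
    exact ⟨s, hs'.1, hs'.2, le_of_lt hs⟩
  have hstep : ∀ x y h : EuclideanSpace ℝ (Fin n), ∀ r : ℝ, 0 < r → ‖h‖ ≤ σ * r →
      r / 2 ≤ ‖x - y‖ → ‖K (x + h) y - K x y‖ + ‖K x (y + h) - K x y‖ ≤
        |C₀| * 2 ^ (d + δ) * σ ^ δ / r ^ d := by
    intro x y h r hr hh hxy
    have hne : x ≠ y := by
      rintro rfl
      rw [sub_self, norm_zero] at hxy
      linarith
    have hσr : σ * r < r / 8 := by nlinarith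
    refine (hsm x y h hne (by linarith)).trans ?_
    calc C₀ * (‖h‖ ^ δ / ‖x - y‖ ^ (d + δ)) ≤ |C₀| * ((σ * r) ^ δ / (r / 2) ^ (d + δ)) := by
          gcongr
          exact le_abs_self _
      _ = _ := by
          rw [Real.mul_rpow hσ0.le hr.le, Real.div_rpow hr.le (by norm_num), Real.rpow_add hr]
          have := (Real.rpow_pos_of_pos hr δ).ne'
          field_simp
  refine ⟨σ, hσ0, hσ8, fun X Y t ht hXY => ?_⟩
  have htp : 0 < |t| := abs_pos.2 ht
  have hXYn : ‖X - Y‖ = |t| := by rw [hXY, norm_smul, hu, mul_one, Real.norm_eq_abs]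
  have hK := hnd X Y t ht hXY
  rw [hXYn] at hK
  have hκ : K X Y ≠ 0 := by
    rw [← norm_pos_iff]
    exact lt_of_lt_of_le (by positivity) hK
  have hκn : ((‖K X Y‖ : ℝ) : 𝕜) ≠ 0 := by simpa using hκ
  -- The phase that rotates `K X Y` onto the positive real axis.
  refine ⟨(starRingEnd 𝕜) (K X Y) / (‖K X Y‖ : ℝ), ?_, fun x y hx hy => ?_⟩
  · rw [norm_div, RCLike.norm_conj, RCLike.norm_ofReal, abs_norm, div_self (norm_ne_zero_iff.2 hκ)]
  set θ : 𝕜 := (starRingEnd 𝕜) (K X Y) / (‖K X Y‖ : ℝ) with hθ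
  have hθ1 : ‖θ‖ = 1 := by
    rw [hθ, norm_div, RCLike.norm_conj, RCLike.norm_ofReal, abs_norm,
      div_self (norm_ne_zero_iff.2 hκ)]
  have hθK : θ * K X Y = (‖K X Y‖ : ℝ) := by
    rw [hθ, div_mul_eq_mul_div, RCLike.conj_mul, pow_two, mul_div_assoc, div_self hκn, mul_one]
  have hXy : |t| / 2 ≤ ‖X - y‖ := by
    have h1 : ‖X - Y‖ ≤ ‖X - y‖ + ‖y - Y‖ := norm_sub_le_norm_sub_add_norm_sub _ _ _
    rw [hXYn] at h1
    nlinarith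
  have e1 := hstep X y (x - X) |t| htp hx hXy
  have e2 := hstep X Y (y - Y) |t| htp hy (by rw [hXYn]; linarith)
  rw [add_sub_cancel] at e1 e2
  have e3 : ‖K x y - K X Y‖ ≤ D * σ ^ δ / |t| ^ d := by
    have h1 : ‖K x y - K X Y‖ ≤ ‖K x y - K X y‖ + ‖K X y - K X Y‖ :=
      norm_sub_le_norm_sub_add_norm_sub _ _ _
    have h2 : D * σ ^ δ / |t| ^ d = |C₀| * 2 ^ (d + δ) * σ ^ δ / |t| ^ d +
      |C₀| * 2 ^ (d + δ) * σ ^ δ / |t| ^ d := by ring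
    linarith [norm_nonneg (K X (y + (x - X)) - K X y), norm_nonneg (K (X + (y - Y)) Y - K X Y)]
  have e4 : D * σ ^ δ / |t| ^ d ≤ a / 2 / |t| ^ d := by gcongr
  have e5 : θ * K x y = (‖K X Y‖ : ℝ) + θ * (K x y - K X Y) := by rw [← hθK]; ring
  rw [e5, map_add, RCLike.ofReal_re]
  have e6 : -‖K x y - K X Y‖ ≤ RCLike.re (θ * (K x y - K X Y)) := by
    have := (abs_le.1 (RCLike.abs_re_le_norm (θ * (K x y - K X Y)))).1
    rwa [norm_mul, hθ1, one_mul] at this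
  have e7 : a / |t| ^ d = a / 2 / |t| ^ d + a / 2 / |t| ^ d := by ring
  linarith

/-- Lower bound for the integral of a kernel against a step function without cancellation. -/
lemma IsFractionalKernel.le_norm_integral_stepFun (hker : IsFractionalKernel α K)
    {x : EuclideanSpace ℝ (Fin n)} {J : Finset ℕ} {S B : ℕ → Set (EuclideanSpace ℝ (Fin n))}
    (hS : ∀ i, MeasurableSet (S i)) (hSB : ∀ i, S i ⊆ B i) (hB : ∀ i, IsCompact (B i))
    (hx : ∀ i ∈ J, x ∉ B i) {w : ℕ → 𝕜} {θ : 𝕜} (hθ : ‖θ‖ = 1) {b : ℕ → ℝ}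
    (hb : ∀ i ∈ J, ∀ y ∈ S i, b i ≤ RCLike.re (θ * K x y * w i)) :
    ∑ i ∈ J, b i * volume.real (S i) ≤ ‖∫ y, K x y * stepFun J S w y‖ := by
  have hint : ∀ i ∈ J, IntegrableOn (fun y => θ * K x y * w i) (S i) := by
    intro i hi
    refine IntegrableOn.mono_set ?_ (hSB i)
    refine ContinuousOn.integrableOn_compact (hB i) ?_
    refine ContinuousOn.mul (continuousOn_const.mul ((hker.continuousOn x).mono fun y hy h => ?_))
      continuousOn_const
    exact hx i hi (by rwa [Set.mem_singleton_iff.1 h] at hy)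
  have e : θ * ∫ y, K x y * stepFun J S w y = ∑ i ∈ J, ∫ y in S i, θ * K x y * w i := by
    rw [← integral_const_mul]
    simp_rw [← integral_indicator (hS _)]
    rw [← integral_finsetSum _ fun i hi => (integrable_indicator_iff (hS i)).2 (hint i hi)]
    congr 1
    ext y
    simp only [stepFun, Finset.mul_sum]
    refine Finset.sum_congr rfl fun i _ => ?_
    by_cases hy : y ∈ S i
    · simp [hy, mul_assoc]
    · simp [hy]
  have hn : ‖∫ y, K x y * stepFun J S w y‖ = ‖θ * ∫ y, K x y * stepFun J S w y‖ := by
    rw [norm_mul, hθ, one_mul]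
  rw [hn]
  refine le_trans ?_ (RCLike.re_le_norm _)
  rw [e, map_sum]
  refine Finset.sum_le_sum fun i hi => ?_
  rw [← integral_re (hint i hi)]
  have hfin : volume (S i) ≠ ∞ := ((measure_mono (hSB i)).trans_lt (hB i).measure_lt_top).ne
  calc b i * volume.real (S i) = ∫ _ in S i, b i := by
        rw [setIntegral_const, smul_eq_mul, mul_comm]
    _ ≤ _ := setIntegral_mono_on (integrableOn_const hfin) (hint i hi).re (hS i) (hb i hi)

/-- Density points, in terms of balls centred off the point. -/
lemma exists_forall_volume_closedBall_le {E : Set (EuclideanSpace ℝ (Fin n))}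
    (hE : volume E ≠ 0) {u : EuclideanSpace ℝ (Fin n)} (hu : ‖u‖ = 1) {σ : ℝ} (hσ : 0 < σ) :
    ∃ (x₀ : EuclideanSpace ℝ (Fin n)) (R : ℝ), 0 < R ∧ R ≤ 1 ∧ ∀ r, 0 < r → r ≤ R →
      volume (Metric.closedBall (x₀ + r • u) (σ * r)) ≤
        2 * volume (E ∩ Metric.closedBall (x₀ + r • u) (σ * r)) := by
  have hne : (ae (volume.restrict E)).NeBot := by
    rw [ae_neBot]
    simpa using hE
  -- The differentiation theorem allows balls that miss the point, provided it lies within a fixed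
  -- multiple of the radius of the centre; here distance over radius is `σ⁻¹`.
  obtain ⟨x₀, hx₀⟩ := (IsUnifLocDoublingMeasure.ae_tendsto_measure_inter_div
    (volume : Measure (EuclideanSpace ℝ (Fin n))) E σ⁻¹).exists
  have h := hx₀ (l := nhdsWithin (0 : ℝ) (Set.Ioi 0)) (fun r : ℝ => x₀ + r • u)
    (fun r : ℝ => σ * r) ?_ ?_
  · have h1 := h.eventually (Ioi_mem_nhds (show (2 : ℝ≥0∞)⁻¹ < 1 by simp))
    obtain ⟨R, hR, hRs⟩ := mem_nhdsGT_iff_exists_Ioc_subset.1 h1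
    refine ⟨x₀, min R 1, lt_min hR one_pos, min_le_right _ _, fun r hr hrR => ?_⟩
    have h2 : (2 : ℝ≥0∞)⁻¹ ≤ volume (E ∩ Metric.closedBall (x₀ + r • u) (σ * r)) /
        volume (Metric.closedBall (x₀ + r • u) (σ * r)) :=
      le_of_lt (hRs ⟨hr, hrR.trans (min_le_left _ _)⟩)
    have hv0 : volume (Metric.closedBall (x₀ + r • u) (σ * r)) ≠ 0 :=
      (Metric.measure_closedBall_pos _ _ (by positivity)).ne'
    rw [ENNReal.le_div_iff_mul_le (Or.inl hv0) (Or.inl measure_closedBall_lt_top.ne),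
      mul_comm, ← div_eq_mul_inv] at h2
    have := (ENNReal.div_le_iff_le_mul (by simp) (by simp)).1 h2
    rwa [mul_comm _ (2 : ℝ≥0∞)] at this
  · refine tendsto_nhdsWithin_of_tendsto_nhds_of_eventually_within _ ?_ ?_
    · have : Continuous fun r : ℝ => σ * r := by fun_prop
      have h := this.tendsto 0
      rw [mul_zero] at h
      exact h.mono_left nhdsWithin_le_nhds
    · filter_upwards [self_mem_nhdsWithin] with r hr
      exact mul_pos hσ hr
  · filter_upwards [self_mem_nhdsWithin] with r hr
    rw [← mul_assoc, inv_mul_cancel₀ hσ.ne', one_mul, mem_closedBall_iff_norm, sub_add_cancel_left,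
      norm_neg, norm_smul, hu, mul_one, Real.norm_of_nonneg (le_of_lt hr)]

end

/-! ### Chains of balls at a density point -/

/-- A geometric sequence of balls, shrinking to a point along the direction `u`, of each of which
the set `E` fills at least half. -/
structure BallChain {n : ℕ} (E : Set (EuclideanSpace ℝ (Fin n))) (u : EuclideanSpace ℝ (Fin n))
    (σ : ℝ) where
  apex : EuclideanSpace ℝ (Fin n)
  scale : ℝ
  scale_pos : 0 < scale
  scale_le_one : scale ≤ 1
  volume_le : ∀ r, 0 < r → r ≤ scale → volume (Metric.closedBall (apex + r • u) (σ * r)) ≤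
    2 * volume (E ∩ Metric.closedBall (apex + r • u) (σ * r))
  measurableSet : MeasurableSet E
  norm_dir : ‖u‖ = 1
  aperture_pos : 0 < σ
  aperture_lt : σ < 1 / 8

namespace BallChain

variable {n : ℕ} {E : Set (EuclideanSpace ℝ (Fin n))} {u : EuclideanSpace ℝ (Fin n)} {σ : ℝ}
  (c : BallChain E u σ)

/-- The distance of the `i`-th centre to the apex. -/
noncomputable def dist (i : ℕ) : ℝ := c.scale * (σ / 2) ^ i

/-- The `i`-th ball. -/
def ball (i : ℕ) : Set (EuclideanSpace ℝ (Fin n)) :=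
  Metric.closedBall (c.apex + c.dist i • u) (σ * c.dist i)

/-- The part of `E` in the `i`-th ball. -/
def piece (i : ℕ) : Set (EuclideanSpace ℝ (Fin n)) := E ∩ c.ball i

lemma ratio_pos (c : BallChain E u σ) : 0 < σ / 2 := half_pos c.aperture_pos

lemma ratio_lt_one (c : BallChain E u σ) : σ / 2 < 1 := by linarith [c.aperture_lt]

lemma dist_pos (i : ℕ) : 0 < c.dist i := mul_pos c.scale_pos (pow_pos c.ratio_pos i)

lemma dist_anti : Antitone c.dist := fun _ _ h =>
  mul_le_mul_of_nonneg_left (pow_le_pow_of_le_one c.ratio_pos.le c.ratio_lt_one.le h)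
    c.scale_pos.le

lemma dist_le_scale (i : ℕ) : c.dist i ≤ c.scale := by
  simpa [dist] using c.dist_anti (Nat.zero_le i)

lemma dist_le_one (i : ℕ) : c.dist i ≤ 1 := (c.dist_le_scale i).trans c.scale_le_one

lemma dist_le_of_lt {i l : ℕ} (h : i < l) : c.dist l ≤ σ / 2 * c.dist i :=
  (c.dist_anti h).trans_eq (by simp only [dist, pow_succ]; ring)

lemma measurableSet_piece (i : ℕ) : MeasurableSet (c.piece i) :=
  c.measurableSet.inter Metric.isClosed_closedBall.measurableSet

lemma piece_subset_ball (i : ℕ) : c.piece i ⊆ c.ball i := Set.inter_subset_right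

lemma isCompact_ball (i : ℕ) : IsCompact (c.ball i) := isCompact_closedBall _ _

lemma norm_sub_center_le {i : ℕ} {x : EuclideanSpace ℝ (Fin n)} (hx : x ∈ c.ball i) :
    ‖x - (c.apex + c.dist i • u)‖ ≤ σ * c.dist i := mem_closedBall_iff_norm.1 hx

lemma norm_smul_dir (i : ℕ) : ‖c.dist i • u‖ = c.dist i := by
  rw [norm_smul, c.norm_dir, mul_one, Real.norm_of_nonneg (c.dist_pos i).le]

/-- The ratio `σ / 2` is chosen for this: `(1 + σ) d_l ≤ (1 + σ) (σ / 2) d_i ≤ σ d_i`. At scale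
`d_i`, every later ball is thus within the tolerance of the phase estimate around the apex. -/
lemma norm_sub_apex_le {i l : ℕ} (h : i < l) {x : EuclideanSpace ℝ (Fin n)} (hx : x ∈ c.ball l) :
    ‖x - c.apex‖ ≤ σ * c.dist i := by
  have h1 : ‖x - c.apex‖ ≤ ‖x - (c.apex + c.dist l • u)‖ + ‖c.dist l • u‖ := by
    refine (norm_add_le _ _).trans' (le_of_eq ?_)
    congr 1
    abel
  rw [c.norm_smul_dir] at h1
  have h2 := c.norm_sub_center_le hx
  have h3 := c.dist_le_of_lt h
  have := c.aperture_lt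
  have := c.aperture_pos
  have := c.dist_pos i
  have := c.dist_pos l
  nlinarith

lemma le_norm_sub_apex {i : ℕ} {x : EuclideanSpace ℝ (Fin n)} (hx : x ∈ c.ball i) :
    (1 - σ) * c.dist i ≤ ‖x - c.apex‖ := by
  have h1 : ‖c.dist i • u‖ ≤ ‖x - c.apex‖ + ‖x - (c.apex + c.dist i • u)‖ := by
    refine (norm_sub_le _ _).trans' (le_of_eq ?_)
    congr 1
    abel
  rw [c.norm_smul_dir] at h1
  linarith [c.norm_sub_center_le hx]

/-- Later balls stay within `σ d_i` of the apex, while the `i`-th keeps a distance of at least `(1 -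
σ) d_i > σ d_i`. -/
lemma disjoint_ball : Pairwise (Function.onFun Disjoint c.ball) := by
  have key : ∀ i l, i < l → Disjoint (c.ball i) (c.ball l) := by
    intro i l h
    rw [Set.disjoint_left]
    intro x hi hl
    have h1 := c.norm_sub_apex_le h hl
    have h2 := c.le_norm_sub_apex hi
    have := c.aperture_lt
    have := c.dist_pos i
    nlinarith
  intro i l hil
  rcases lt_or_gt_of_ne hil with h | h
  · exact key i l h
  · exact (key l i h).symm

lemma disjoint_piece : Pairwise (Function.onFun Disjoint c.piece) := fun _ _ h =>
  (c.disjoint_ball h).mono (c.piece_subset_ball _) (c.piece_subset_ball _)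

lemma ball_volume_pos (c : BallChain E u σ) : 0 < volume.real (Metric.closedBall (0 : EuclideanSpace ℝ (Fin n)) σ) :=
  ENNReal.toReal_pos (Metric.measure_closedBall_pos _ _ c.aperture_pos).ne'
    measure_closedBall_lt_top.ne

lemma volume_ball (i : ℕ) : volume (c.ball i) =
    ENNReal.ofReal (c.dist i ^ n * volume.real (Metric.closedBall (0 : EuclideanSpace ℝ (Fin n)) σ))
    := by
  rw [ball, mul_comm σ, Measure.addHaar_closedBall_mul _ _ (c.dist_pos i).le c.aperture_pos.le,
    finrank_euclideanSpace_fin, ENNReal.ofReal_mul (pow_nonneg (c.dist_pos i).le _),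
    ofReal_measureReal measure_closedBall_lt_top.ne]

lemma volume_piece_le (i : ℕ) : volume (c.piece i) ≤
    ENNReal.ofReal (c.dist i ^ n * volume.real (Metric.closedBall (0 : EuclideanSpace ℝ (Fin n)) σ))
    := (measure_mono (c.piece_subset_ball i)).trans_eq (c.volume_ball i)

lemma volume_piece_ne_top (i : ℕ) : volume (c.piece i) ≠ ∞ :=
  ((c.volume_piece_le i).trans_lt ENNReal.ofReal_lt_top).ne

lemma le_volume_piece (i : ℕ) :
    c.dist i ^ n * volume.real (Metric.closedBall (0 : EuclideanSpace ℝ (Fin n)) σ) / 2 ≤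
      volume.real (c.piece i) := by
  have h := c.volume_le _ (c.dist_pos i) (c.dist_le_scale i)
  change volume (c.ball i) ≤ 2 * volume (c.piece i) at h
  rw [c.volume_ball, ENNReal.ofReal_le_iff_le_toReal
    (ENNReal.mul_ne_top ENNReal.ofNat_ne_top (c.volume_piece_ne_top i)), ENNReal.toReal_mul,
    ENNReal.toReal_ofNat] at h
  rw [← measureReal_def] at h
  linarith

variable {𝕜 : Type*} [RCLike 𝕜] {p q : EuclideanSpace ℝ (Fin n) → ℝ≥0∞} {α : ℝ}
  {K : EuclideanSpace ℝ (Fin n) → EuclideanSpace ℝ (Fin n) → 𝕜}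
  {T : (EuclideanSpace ℝ (Fin n) → 𝕜) → (EuclideanSpace ℝ (Fin n) → 𝕜)}

/-- Hölder's inequality for step functions on the pieces of a chain. -/
lemma varNorm_stepFun_le (hp : IsExponent p) (hq : IsExponent q) (hn : 0 < n) (hα : 0 ≤ α)
    (hpq : ∀ᵐ x, (p x)⁻¹ = (q x)⁻¹ + ENNReal.ofReal (α / n)) {J : Finset ℕ} (hJ : 0 < J.card)
    {w w' : ℕ → 𝕜} (hw : ∀ i ∈ J, ‖w i‖ ≤ ‖w' i‖ * c.dist i ^ (-α)) :
    varNorm p (stepFun J c.piece w) ≤ 2 * (ENNReal.ofReal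
      ((J.card * volume.real (Metric.closedBall (0 : EuclideanSpace ℝ (Fin n)) σ)) ^ (α / n)) *
        varNorm q (stepFun J c.piece w')) := by
  set v := volume.real (Metric.closedBall (0 : EuclideanSpace ℝ (Fin n)) σ) with hv
  have hv0 : 0 < v := c.ball_volume_pos
  have hk0 : (0 : ℝ) < J.card := by exact_mod_cast hJ
  have hn0 : (0 : ℝ) < n := by exact_mod_cast hn
  have hβ : 0 ≤ α / n := by positivity
  have hd := c.dist_pos
  set Λ : ℝ := (J.card * v) ^ (α / n) with hΛ
  have hΛ0 : 0 < Λ := by positivity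
  have hmul : varNorm q (Λ • stepFun J c.piece w') ≤
      ENNReal.ofReal Λ * varNorm q (stepFun J c.piece w') := by
    refine varNorm_le_mul hΛ0 (Filter.Eventually.of_forall fun x => ?_)
    rw [Pi.smul_apply, enorm_smul, Real.enorm_eq_ofReal hΛ0.le]
  refine le_trans ?_ (mul_le_mul_right hmul 2)
  -- The weight gives each of the `#J` pieces mass at most `1 / #J`. Its power `α / n` is `Λ⁻¹ d_i ^
  -- (-α)` on the `i`-th piece, which is where the loss `Λ` comes from.
  refine varNorm_le_two_mul_of_holder hp hq hβ hpq
    (ψ := stepFun J c.piece fun i => ENNReal.ofReal ((J.card * v * c.dist i ^ n)⁻¹))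
    (measurable_stepFun c.measurableSet_piece) ?_ (Filter.Eventually.of_forall fun x => ?_)
  · simp only [stepFun]
    rw [lintegral_finsetSum _ fun i _ => measurable_const.indicator (c.measurableSet_piece i)]
    calc _ ≤ ∑ i ∈ J, ENNReal.ofReal ((J.card : ℝ)⁻¹) := by
          refine Finset.sum_le_sum fun i _ => ?_
          rw [lintegral_indicator_const (c.measurableSet_piece i)]
          refine (mul_le_mul_right (c.volume_piece_le i) _).trans ?_
          have := hd i
          rw [← ENNReal.ofReal_mul (by positivity), ← hv]
          refine ENNReal.ofReal_le_ofReal (le_of_eq ?_)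
          field_simp
      _ = 1 := by
          rw [Finset.sum_const, nsmul_eq_mul, ENNReal.ofReal_inv_of_pos hk0,
            ENNReal.ofReal_natCast]
          exact ENNReal.mul_inv_cancel (by exact_mod_cast hJ.ne') (ENNReal.natCast_ne_top _)
  · by_cases hx : ∃ i ∈ J, x ∈ c.piece i
    · obtain ⟨i, hi, hxi⟩ := hx
      have := hd i
      rw [Pi.smul_apply, stepFun_of_mem c.disjoint_piece hi hxi,
        stepFun_of_mem c.disjoint_piece hi hxi, stepFun_of_mem c.disjoint_piece hi hxi,
        ENNReal.ofReal_rpow_of_pos (by positivity), ← ofReal_norm, ← ofReal_norm,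
        ← ENNReal.ofReal_mul (norm_nonneg _), norm_smul, Real.norm_of_nonneg hΛ0.le]
      refine ENNReal.ofReal_le_ofReal ((hw i hi).trans_eq ?_)
      have e : ((J.card * v * c.dist i ^ n)⁻¹) ^ (α / n) = Λ⁻¹ * c.dist i ^ (-α) := by
        rw [mul_inv, Real.mul_rpow (by positivity) (by positivity),
          Real.inv_rpow (by positivity), ← hΛ, ← Real.rpow_natCast, ← Real.rpow_neg this.le,
          ← Real.rpow_mul this.le]
        congr 2
        field_simp
      rw [e]
      field_simp
    · push Not at hx
      rw [stepFun_of_notMem hx, enorm_zero]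
      exact zero_le

/-- If `T` applied to a step function is, without cancellation, bounded below on other pieces of
the chain, then its norm is. -/
lemma varNorm_stepFun_le_of_phase {a : ℝ} (ha : 0 < a) (hT : IsFractionalCZO α K T)
    {J J' : Finset ℕ} (hJ : 0 < J.card) (hJJ : Disjoint J J') {w w' : ℕ → 𝕜}
    (hphase : ∀ i ∈ J', ∀ x ∈ c.ball i, ∃ θ : 𝕜, ‖θ‖ = 1 ∧ ∀ l ∈ J, ∀ y ∈ c.ball l,
      a / 2 * ‖w' i‖ * (c.dist l ^ n)⁻¹ ≤ RCLike.re (θ * K x y * w l)) :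
    varNorm q (stepFun J' c.piece w') ≤ ENNReal.ofReal
      (4 / (a * (J.card * volume.real (Metric.closedBall (0 : EuclideanSpace ℝ (Fin n)) σ)))) *
        varNorm q (T (stepFun J c.piece w)) := by
  obtain ⟨hker, r, s, -, -, -, -, hTint⟩ := hT
  set v := volume.real (Metric.closedBall (0 : EuclideanSpace ℝ (Fin n)) σ) with hv
  have hv0 : 0 < v := c.ball_volume_pos
  have hk0 : (0 : ℝ) < J.card := by exact_mod_cast hJ
  have hd := c.dist_pos
  set f : EuclideanSpace ℝ (Fin n) → 𝕜 := stepFun J c.piece w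
  have hcomp : IsCompact (⋃ l ∈ J, c.ball l) := J.isCompact_biUnion fun l _ => c.isCompact_ball l
  have hsupp : Function.support f ⊆ ⋃ l ∈ J, c.ball l := by
    intro x hx
    by_contra hne
    refine hx (stepFun_of_notMem fun l hl hxl => hne ?_)
    exact Set.mem_biUnion hl (c.piece_subset_ball l hxl)
  have htsupp : tsupport f ⊆ ⋃ l ∈ J, c.ball l := closure_minimal hsupp hcomp.isClosed
  have hcs : HasCompactSupport f := hcomp.of_isClosed_subset (isClosed_tsupport f) htsupp
  have hf : MemLp f r volume := by
    refine memLp_finsetSum _ fun i _ => ?_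
    exact memLp_indicator_const r (c.measurableSet_piece i) _
      (Or.inr (c.volume_piece_ne_top i))
  refine varNorm_le_mul (by positivity) ?_
  filter_upwards [hTint f hf hcs] with x hx
  by_cases hxJ : ∃ i ∈ J', x ∈ c.piece i
  · obtain ⟨i, hi, hxi⟩ := hxJ
    have hxb := c.piece_subset_ball i hxi
    have hxl : ∀ l ∈ J, x ∉ c.ball l := fun l hl hxl => by
      have hne : l ≠ i := fun h => Finset.disjoint_left.1 hJJ hl (h ▸ hi)
      exact Set.disjoint_left.1 (c.disjoint_ball hne) hxl hxb
    have hTx := hx fun h => by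
      obtain ⟨l, hl, hxl'⟩ := Set.mem_iUnion₂.1 (htsupp h)
      exact hxl l hl hxl'
    obtain ⟨θ, hθ, hlow⟩ := hphase i hi x hxb
    have key := hker.le_norm_integral_stepFun c.measurableSet_piece c.piece_subset_ball
      c.isCompact_ball hxl hθ (b := fun l => a / 2 * ‖w' i‖ * (c.dist l ^ n)⁻¹)
      fun l hl y hy => hlow l hl y (c.piece_subset_ball l hy)
    rw [← hTx] at key
    rw [stepFun_of_mem c.disjoint_piece hi hxi, ← ofReal_norm, ← ofReal_norm,
      ← ENNReal.ofReal_mul (by positivity)]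
    refine ENNReal.ofReal_le_ofReal ?_
    -- Each piece has measure at least `d_l ^ n v / 2`, which cancels `d_l ^ (-n)`: all terms
    -- contribute equally, and their number is the gain.
    have h1 : ∑ _l ∈ J, a * v * ‖w' i‖ / 4 ≤ ‖T f x‖ := by
      refine le_trans (Finset.sum_le_sum fun l _ => ?_) key
      have := hd l
      calc a * v * ‖w' i‖ / 4 = a / 2 * ‖w' i‖ * (c.dist l ^ n)⁻¹ * (c.dist l ^ n * v / 2) := by
            field_simp; norm_num
        _ ≤ _ := by gcongr; exact c.le_volume_piece l
    rw [Finset.sum_const, nsmul_eq_mul] at h1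
    rw [div_mul_eq_mul_div, le_div_iff₀ (by positivity)]
    linarith
  · push Not at hxJ
    rw [stepFun_of_notMem hxJ, enorm_zero]
    exact zero_le

lemma memVarLp_stepFun (hp : IsExponent p) (J : Finset ℕ) (w : ℕ → 𝕜) :
    MemVarLp p (stepFun J c.piece w) := by
  refine memVarLp_of_bounded hp (measurable_stepFun c.measurableSet_piece).aestronglyMeasurable
    (S := ⋃ i ∈ J, c.piece i) (Finset.measurableSet_biUnion _ fun i _ => c.measurableSet_piece i)
    ?_ (M := ∑ i ∈ J, ‖w i‖) (fun x => ?_) fun x hx => ?_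
  · exact ((measure_biUnion_finset_le _ _).trans_lt
      (ENNReal.sum_lt_top.2 fun i _ => (c.volume_piece_ne_top i).lt_top)).ne
  · exact stepFun_norm_le c.disjoint_piece (Finset.sum_nonneg fun _ _ => norm_nonneg _)
      (fun i hi => Finset.single_le_sum (f := fun i => ‖w i‖) (fun _ _ => norm_nonneg _) hi) x
  · exact stepFun_of_notMem fun i hi hxi => hx (Set.mem_biUnion hi hxi)

end BallChain

lemma exists_ballChain {n : ℕ} {E : Set (EuclideanSpace ℝ (Fin n))} (hE : MeasurableSet E)
    (hE0 : volume E ≠ 0) {u : EuclideanSpace ℝ (Fin n)} (hu : ‖u‖ = 1) {σ : ℝ} (hσ : 0 < σ)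
    (hσ8 : σ < 1 / 8) : Nonempty (BallChain E u σ) := by
  obtain ⟨x₀, R, hR, hR1, h⟩ := exists_forall_volume_closedBall_le hE0 hu hσ
  exact ⟨⟨x₀, R, hR, hR1, h, hE, hu, hσ, hσ8⟩⟩

/-! ### Limits and blocks of indices -/

lemma ENNReal.eq_zero_of_forall_le_mul_pow {x C r : ℝ≥0∞} (hC : C ≠ ∞) (hr : r < 1)
    (h : ∀ j : ℕ, x ≤ C * r ^ j) : x = 0 := by
  have := ENNReal.Tendsto.const_mul (ENNReal.tendsto_pow_atTop_nhds_zero_of_lt_one hr)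
    (Or.inr hC)
  rw [mul_zero] at this
  exact le_antisymm (ge_of_tendsto' this h) zero_le

lemma exists_nat_mul_rpow_div_lt {D v β : ℝ} (hv : 0 < v) (hβ : β < 1) :
    ∃ k : ℕ, 0 < k ∧ D * (((k : ℝ) * v) ^ β / (k * v)) < 1 := by
  have h1 : Filter.Tendsto (fun k : ℕ => (k : ℝ) * v) Filter.atTop Filter.atTop :=
    tendsto_natCast_atTop_atTop.atTop_mul_const hv
  have h2 := ((tendsto_rpow_neg_atTop (sub_pos.2 hβ)).comp h1).const_mul D
  rw [mul_zero] at h2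
  obtain ⟨k, hk, hk0⟩ :=
    ((h2.eventually (Iio_mem_nhds one_pos)).and (Filter.eventually_gt_atTop 0)).exists
  refine ⟨k, hk0, ?_⟩
  have hkv : (0 : ℝ) < k * v := mul_pos (by exact_mod_cast hk0) hv
  have e : -(1 - β) = β - 1 := by ring
  simp only [Function.comp, e] at hk
  rwa [Real.rpow_sub_one hkv.ne'] at hk

/-- The `j`-th block of `k` consecutive natural numbers. -/
def natBlock (k j : ℕ) : Finset ℕ := Finset.Ico (j * k) (j * k + k)

lemma card_natBlock (k j : ℕ) : (natBlock k j).card = k := by simp [natBlock]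

lemma lt_of_mem_natBlock {k j i l : ℕ} (hi : i ∈ natBlock k j) (hl : l ∈ natBlock k (j + 1)) :
    i < l := by
  rw [natBlock, Finset.mem_Ico] at hi hl
  rw [add_mul, one_mul] at hl
  omega

lemma disjoint_natBlock (k j : ℕ) : Disjoint (natBlock k (j + 1)) (natBlock k j) :=
  Finset.disjoint_left.2 fun _ h h' => (lt_of_mem_natBlock h' h).false

lemma mul_mem_natBlock {k : ℕ} (hk : 0 < k) (j : ℕ) : j * k ∈ natBlock k j := by
  simp [natBlock, hk]

/-! ### Comparison of consecutive blocks, and growth of their norms -/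

namespace BallChain

variable {n : ℕ} {E : Set (EuclideanSpace ℝ (Fin n))} {u : EuclideanSpace ℝ (Fin n)} {σ : ℝ}
  (c : BallChain E u σ) {𝕜 : Type*} [RCLike 𝕜] {p q : EuclideanSpace ℝ (Fin n) → ℝ≥0∞} {α a : ℝ}
  {K : EuclideanSpace ℝ (Fin n) → EuclideanSpace ℝ (Fin n) → 𝕜}
  {T : (EuclideanSpace ℝ (Fin n) → 𝕜) → (EuclideanSpace ℝ (Fin n) → 𝕜)}

/-- The `k`-th root compensates the block length, so that the rate per block is `σ / 2` whatever `k`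
is. -/
lemma dist_mul_rpow_inv {k : ℕ} (hk : 0 < k) (j : ℕ) :
    c.dist (j * k) ^ (k : ℝ)⁻¹ = c.scale ^ (k : ℝ)⁻¹ * (σ / 2) ^ j := by
  have := c.ratio_pos
  rw [dist, Real.mul_rpow c.scale_pos.le (by positivity), pow_mul,
    Real.pow_rpow_inv_natCast (by positivity) hk.ne']

/-- The source is the inner block, which looks like the apex from each outer ball. The phase depends
only on the target ball and can be taken out of the integral, so the coefficients may be positive.
-/
lemma varNorm_block_le_succ (hp : IsExponent p) (hq : IsExponent q) (hn : 0 < n) (hα : 0 ≤ α)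
    (hpq : ∀ᵐ x, (p x)⁻¹ = (q x)⁻¹ + ENNReal.ofReal (α / n)) (ha : 0 < a)
    (hT : IsFractionalCZO α K T) {C : ℝ≥0}
    (hC : ∀ f, MemVarLp p f → varNorm q (T f) ≤ C * varNorm p f)
    (hphase : ∀ (X Y : EuclideanSpace ℝ (Fin n)) (t : ℝ), t ≠ 0 →
      X - Y = t • u → ∃ θ : 𝕜, ‖θ‖ = 1 ∧ ∀ x y, ‖x - X‖ ≤ σ * |t| → ‖y - Y‖ ≤ σ * |t| →
        a / 2 / |t| ^ ((n : ℝ) - α) ≤ RCLike.re (θ * K x y)) {k : ℕ} (hk : 0 < k) (j : ℕ) :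
    varNorm p (stepFun (natBlock k j) c.piece fun i => (((c.dist i ^ n)⁻¹ : ℝ) : 𝕜)) ≤
      2 * (ENNReal.ofReal ((k *
        volume.real (Metric.closedBall (0 : EuclideanSpace ℝ (Fin n)) σ)) ^ (α / n)) *
      (ENNReal.ofReal
        (4 / (a * (k * volume.real (Metric.closedBall (0 : EuclideanSpace ℝ (Fin n)) σ)))) * (C *
      varNorm p (stepFun (natBlock k (j + 1)) c.piece fun i => (((c.dist i ^ n)⁻¹ : ℝ) : 𝕜))))) := by
  have hd := c.dist_pos
  have h1 := c.varNorm_stepFun_le hp hq hn hα hpq (J := natBlock k j) (by rwa [card_natBlock])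
    (w := fun i => (((c.dist i ^ n)⁻¹ : ℝ) : 𝕜))
    (w' := fun i => (((c.dist i ^ ((n : ℝ) - α))⁻¹ : ℝ) : 𝕜)) fun i _ => by
      have := hd i
      rw [RCLike.norm_ofReal, RCLike.norm_ofReal, abs_of_pos (by positivity),
        abs_of_pos (by positivity), ← Real.rpow_neg this.le, ← Real.rpow_add this,
        ← Real.rpow_natCast, ← Real.rpow_neg this.le]
      exact le_of_eq (by congr 1; ring)
  have h2 := c.varNorm_stepFun_le_of_phase (q := q) ha hT (J := natBlock k (j + 1))
    (J' := natBlock k j)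
    (by rwa [card_natBlock]) (disjoint_natBlock k j)
    (w := fun i => (((c.dist i ^ n)⁻¹ : ℝ) : 𝕜))
    (w' := fun i => (((c.dist i ^ ((n : ℝ) - α))⁻¹ : ℝ) : 𝕜)) fun i hi x hx => by
      obtain ⟨θ, hθ, h⟩ := hphase (c.apex + c.dist i • u) c.apex (c.dist i) (hd i).ne'
        (add_sub_cancel_left _ _)
      refine ⟨θ, hθ, fun l hl y hy => ?_⟩
      rw [abs_of_pos (hd i)] at h
      have := h x y (c.norm_sub_center_le hx) (c.norm_sub_apex_le (lt_of_mem_natBlock hi hl) hy)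
      have hdi := hd i
      have hdl := hd l
      rw [RCLike.norm_ofReal, abs_of_pos (by positivity), mul_comm _ (((_ : ℝ) : 𝕜)),
        RCLike.re_ofReal_mul, mul_comm]
      gcongr
      simpa [div_eq_mul_inv] using this
  rw [card_natBlock] at h1 h2
  refine h1.trans ?_
  gcongr
  refine h2.trans ?_
  gcongr
  exact hC _ (c.memVarLp_stepFun hp _ _)

/-- The source is now the outer block and the target looks like the apex. The phase depends on the
source ball, so it is built into the coefficients `θ l * d_l ^ (-α)`; Hölder sees only their
absolute values. -/
lemma varNorm_block_succ_le (hp : IsExponent p) (hq : IsExponent q) (hn : 0 < n) (hα : 0 ≤ α)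
    (hpq : ∀ᵐ x, (p x)⁻¹ = (q x)⁻¹ + ENNReal.ofReal (α / n)) (ha : 0 < a)
    (hT : IsFractionalCZO α K T) {C : ℝ≥0}
    (hC : ∀ f, MemVarLp p f → varNorm q (T f) ≤ C * varNorm p f)
    (hphase : ∀ (X Y : EuclideanSpace ℝ (Fin n)) (t : ℝ), t ≠ 0 →
      X - Y = t • u → ∃ θ : 𝕜, ‖θ‖ = 1 ∧ ∀ x y, ‖x - X‖ ≤ σ * |t| → ‖y - Y‖ ≤ σ * |t| →
        a / 2 / |t| ^ ((n : ℝ) - α) ≤ RCLike.re (θ * K x y)) {k : ℕ} (hk : 0 < k) (j : ℕ) :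
    varNorm q (stepFun (natBlock k (j + 1)) c.piece fun _ => (1 : 𝕜)) ≤
      ENNReal.ofReal
        (4 / (a * (k * volume.real (Metric.closedBall (0 : EuclideanSpace ℝ (Fin n)) σ)))) * (C *
      (2 * (ENNReal.ofReal ((k *
        volume.real (Metric.closedBall (0 : EuclideanSpace ℝ (Fin n)) σ)) ^ (α / n)) *
      varNorm q (stepFun (natBlock k j) c.piece fun _ => (1 : 𝕜))))) := by
  have hd := c.dist_pos
  choose θ hθ h using fun l => hphase c.apex (c.apex + c.dist l • u) (-c.dist l)
    (neg_ne_zero.2 (hd l).ne') (by simp)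
  have h1 := c.varNorm_stepFun_le hp hq hn hα hpq (J := natBlock k j) (by rwa [card_natBlock])
    (w := fun l => θ l * ((c.dist l ^ (-α) : ℝ) : 𝕜)) (w' := fun _ => (1 : 𝕜)) fun l _ => by
      have := hd l
      rw [norm_mul, hθ, norm_one, RCLike.norm_ofReal, abs_of_pos (by positivity)]
  have h2 := c.varNorm_stepFun_le_of_phase (q := q) ha hT (J := natBlock k j)
    (J' := natBlock k (j + 1)) (by rwa [card_natBlock]) (disjoint_natBlock k j).symm
    (w := fun l => θ l * ((c.dist l ^ (-α) : ℝ) : 𝕜)) (w' := fun _ => (1 : 𝕜))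
    fun i hi x hx => by
      refine ⟨1, norm_one, fun l hl y hy => ?_⟩
      have hl' := h l x y
      rw [abs_neg, abs_of_pos (hd l)] at hl'
      have := hl' (c.norm_sub_apex_le (lt_of_mem_natBlock hl hi) hx) (c.norm_sub_center_le hy)
      have hdl := hd l
      have e : 1 * K x y * (θ l * ((c.dist l ^ (-α) : ℝ) : 𝕜)) =
        ((c.dist l ^ (-α) : ℝ) : 𝕜) * (θ l * K x y) := by ring
      rw [e, RCLike.re_ofReal_mul, norm_one, mul_one]
      have e2 : (c.dist l ^ n)⁻¹ = c.dist l ^ (-α) * (c.dist l ^ ((n : ℝ) - α))⁻¹ := by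
        rw [← Real.rpow_natCast, ← Real.rpow_neg hdl.le, ← Real.rpow_neg hdl.le,
          ← Real.rpow_add hdl]
        congr 1
        ring
      rw [e2, mul_left_comm]
      gcongr
      rwa [← div_eq_mul_inv]
  rw [card_natBlock] at h1 h2
  refine h2.trans ?_
  gcongr
  exact (hC _ (c.memVarLp_stepFun hp _ _)).trans (by gcongr)

/-- With `ρ` the first distance of the next block, the values are at most `ρ ^ (-n)` on a set of
measure comparable to `ρ ^ n`. The excess `1 / (k n)` of the exponent leaves `ρ ^ (-1 / k)`, which
grows by `2 / σ` per block. -/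
lemma varNorm_block_le_geometric (hp : IsExponent p) (hn : 0 < n) {k : ℕ} (hk : 0 < k)
    (hE : ∀ x ∈ E, p x ≤ ENNReal.ofReal (1 + ((k : ℝ) * n)⁻¹)) :
    ∃ D : ℝ, ∀ j,
      varNorm p (stepFun (natBlock k j) c.piece fun i => (((c.dist i ^ n)⁻¹ : ℝ) : 𝕜)) ≤
        ENNReal.ofReal D * ENNReal.ofReal (σ / 2)⁻¹ ^ j := by
  set v := volume.real (Metric.closedBall (0 : EuclideanSpace ℝ (Fin n)) σ) with hv
  have hv0 : 0 < v := c.ball_volume_pos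
  have hk0 : (0 : ℝ) < k := by exact_mod_cast hk
  have hn0 : (0 : ℝ) < n := by exact_mod_cast hn
  have hd := c.dist_pos
  have hs := c.scale_pos
  set A := (σ / 2)⁻¹ with hA
  have hA1 : 1 ≤ A := (one_le_inv₀ c.ratio_pos).2 c.ratio_lt_one.le
  have hA0 : 0 < A := by linarith
  set D : ℝ := (c.scale ^ (k : ℝ)⁻¹)⁻¹ * A * A ^ (k * n) * k * v
  have hD0 : 0 ≤ D := by positivity
  -- The summand `1` takes care of the maximum with `1` in `varNorm_le_max_one`.
  refine ⟨1 + D, fun j => ?_⟩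
  rw [← ENNReal.ofReal_pow hA0.le, ← ENNReal.ofReal_mul (by positivity)]
  refine (varNorm_le_max_one hp).trans (max_le ?_ ?_)
  · rw [ENNReal.one_le_ofReal]
    exact one_le_mul_of_one_le_of_one_le (by linarith) (one_le_pow₀ hA1)
  set ρ := c.dist ((j + 1) * k) with hρ
  have hρ0 : 0 < ρ := hd _
  have hlast : ∀ i ∈ natBlock k j, ρ ≤ c.dist i ∧ c.dist i ≤ A ^ k * ρ := by
    intro i hi
    rw [natBlock, Finset.mem_Ico] at hi
    refine ⟨c.dist_anti (by rw [add_mul, one_mul]; exact hi.2.le), (c.dist_anti hi.1).trans ?_⟩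
    rw [hρ, dist, dist, add_mul, one_mul, pow_add, hA, inv_pow]
    have := pow_pos c.ratio_pos k
    refine le_of_eq ?_
    field_simp
  have hmeas : MeasurableSet (⋃ i ∈ natBlock k j, c.piece i) :=
    Finset.measurableSet_biUnion _ fun i _ => c.measurableSet_piece i
  have hM1 : 1 ≤ (ρ ^ n)⁻¹ :=
    (one_le_inv₀ (by positivity)).2 (pow_le_one₀ hρ0.le (c.dist_le_one _))
  refine (varModular_le_of_exponent_le (P := 1 + ((k : ℝ) * n)⁻¹) (M := (ρ ^ n)⁻¹) hmeas hp
    (fun x hx => ?_) hM1 (fun x => ?_) fun x hx => ?_).trans ?_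
  · obtain ⟨i, -, hi⟩ := Set.mem_iUnion₂.1 hx
    exact hE x hi.1
  · refine stepFun_norm_le c.disjoint_piece (by positivity) (fun i hi => ?_) x
    have := hd i
    rw [RCLike.norm_ofReal, abs_of_pos (by positivity)]
    gcongr
    exact (hlast i hi).1
  · exact stepFun_of_notMem fun i hi hxi => hx (Set.mem_biUnion hi hxi)
  have hvol : volume (⋃ i ∈ natBlock k j, c.piece i) ≤
      ENNReal.ofReal (k * ((A ^ k * ρ) ^ n * v)) := by
    refine (measure_biUnion_finset_le _ _).trans ?_
    calc _ ≤ ∑ _i ∈ natBlock k j, ENNReal.ofReal ((A ^ k * ρ) ^ n * v) := by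
          refine Finset.sum_le_sum fun i hi => (c.volume_piece_le i).trans ?_
          refine ENNReal.ofReal_le_ofReal ?_
          have := (hd i).le
          have := (hlast i hi).2
          gcongr
      _ = _ := by
          rw [Finset.sum_const, card_natBlock, nsmul_eq_mul, ENNReal.ofReal_mul hk0.le,
            ENNReal.ofReal_natCast]
  have hpow : ((ρ ^ n)⁻¹) ^ (1 + ((k : ℝ) * n)⁻¹) =
      (ρ ^ n)⁻¹ * ((c.scale ^ (k : ℝ)⁻¹)⁻¹ * A ^ (j + 1)) := by
    rw [Real.rpow_add (by positivity), Real.rpow_one, Real.inv_rpow (by positivity) (((k : ℝ) * n)⁻¹)]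
    congr 1
    have e : (ρ ^ n) ^ ((k : ℝ) * n)⁻¹ = ρ ^ (k : ℝ)⁻¹ := by
      rw [← Real.rpow_natCast, ← Real.rpow_mul hρ0.le]
      congr 1
      field_simp
    rw [e, hρ, c.dist_mul_rpow_inv hk, mul_inv, hA, inv_pow]
  calc _ ≤ ENNReal.ofReal (((ρ ^ n)⁻¹) ^ (1 + ((k : ℝ) * n)⁻¹)) *
        ENNReal.ofReal (k * ((A ^ k * ρ) ^ n * v)) := by gcongr
    _ = ENNReal.ofReal (D * A ^ j) := by
        rw [← ENNReal.ofReal_mul (by positivity), hpow]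
        congr 1
        rw [mul_pow, ← pow_mul, pow_succ]
        simp only [D]
        field_simp
    _ ≤ _ := by gcongr; linarith

/-- The first piece of the block suffices: its measure is comparable to `d ^ n`, and the power `1 /
(k n)` makes this `d ^ (1 / k)`. -/
lemma geometric_le_varNorm_block (hq : IsExponent q) (hn : 0 < n) {k : ℕ} (hk : 0 < k)
    (hE : ∀ x ∈ E, ENNReal.ofReal ((k : ℝ) * n) ≤ q x) :
    ∃ d : ℝ, 0 < d ∧ ∀ j, ENNReal.ofReal (d * (σ / 2) ^ j) ≤
      varNorm q (stepFun (natBlock k j) c.piece fun _ => (1 : 𝕜)) := by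
  set v := volume.real (Metric.closedBall (0 : EuclideanSpace ℝ (Fin n)) σ) with hv
  have hv0 : 0 < v := c.ball_volume_pos
  have hk1 : (1 : ℝ) ≤ k := by exact_mod_cast hk
  have hn1 : (1 : ℝ) ≤ n := by exact_mod_cast hn
  have hd := c.dist_pos
  have hs := c.scale_pos
  set m := min 1 (v / 2)
  have hm0 : 0 < m := lt_min one_pos (by positivity)
  refine ⟨m ^ ((k : ℝ) * n)⁻¹ * c.scale ^ (k : ℝ)⁻¹, by positivity, fun j => ?_⟩
  have hdj := hd (j * k)
  have h := le_varNorm_of_le_exponent (f := stepFun (natBlock k j) c.piece fun _ => (1 : 𝕜))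
    (Q := (k : ℝ) * n) (by nlinarith) hq (c.measurableSet_piece (j * k)) (fun x hx => hE x hx.1)
    (w := 1) (m := m * c.dist (j * k) ^ n) one_pos (by positivity)
    (mul_le_one₀ (min_le_left _ _) (by positivity) (pow_le_one₀ hdj.le (c.dist_le_one _))) ?_ ?_
  · refine le_trans (ENNReal.ofReal_le_ofReal (le_of_eq ?_)) h
    rw [one_mul, Real.mul_rpow hm0.le (by positivity), mul_assoc, ← c.dist_mul_rpow_inv hk]
    congr 1
    rw [← Real.rpow_natCast (c.dist (j * k)) n, ← Real.rpow_mul hdj.le]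
    congr 1
    field_simp
  · rw [ENNReal.ofReal_le_iff_le_toReal (c.volume_piece_ne_top _), ← measureReal_def]
    refine le_trans ?_ (c.le_volume_piece (j * k))
    have : m ≤ v / 2 := min_le_right _ _
    calc m * c.dist (j * k) ^ n ≤ v / 2 * c.dist (j * k) ^ n := by gcongr
      _ = _ := by ring
  · intro x hx
    rw [stepFun_of_mem c.disjoint_piece (mul_mem_natBlock hk j) hx, norm_one]

end BallChain

/-! ### Iteration over the blocks and the contradictions -/

section

variable {𝕜 : Type*} [RCLike 𝕜] {n : ℕ} {p q : EuclideanSpace ℝ (Fin n) → ℝ≥0∞}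
  {α a σ : ℝ} {u : EuclideanSpace ℝ (Fin n)}
  {K : EuclideanSpace ℝ (Fin n) → EuclideanSpace ℝ (Fin n) → 𝕜}
  {T : (EuclideanSpace ℝ (Fin n) → 𝕜) → (EuclideanSpace ℝ (Fin n) → 𝕜)}

/-- The product is a constant times `(k v) ^ (β - 1)`. The last factor is the growth rate `2 / σ`
that the gain has to beat. -/
lemma exists_block_length (ha : 0 < a) (hσ : 0 < σ) {v β : ℝ} (hv : 0 < v) (hβ : β < 1)
    (C : ℝ≥0) : ∃ k : ℕ, 0 < k ∧ 2 * (ENNReal.ofReal ((k * v) ^ β) *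
      (ENNReal.ofReal (4 / (a * (k * v))) * C)) * ENNReal.ofReal (σ / 2)⁻¹ < 1 := by
  obtain ⟨k, hk, h⟩ := exists_nat_mul_rpow_div_lt (D := 8 * C * (σ / 2)⁻¹ / a) hv hβ
  refine ⟨k, hk, ?_⟩
  have hk0 : (0 : ℝ) < k := by exact_mod_cast hk
  have h2 : (2 : ℝ≥0∞) = ENNReal.ofReal 2 := by simp
  rw [h2, ← ENNReal.ofReal_coe_nnreal, ← ENNReal.ofReal_mul (by positivity),
    ← ENNReal.ofReal_mul (by positivity), ← ENNReal.ofReal_mul (by positivity),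
    ← ENNReal.ofReal_mul (by positivity), ENNReal.ofReal_lt_one]
  refine lt_of_eq_of_lt ?_ h
  field_simp
  ring

lemma exists_volume_exponent_le_eq_zero (hp : IsExponent p) (hq : IsExponent q) (hn : 0 < n)
    (hα : 0 ≤ α) (hαn : α < n)
    (hpq : ∀ᵐ x, (p x)⁻¹ = (q x)⁻¹ + ENNReal.ofReal (α / n)) (ha : 0 < a) (hu : ‖u‖ = 1)
    (hσ : 0 < σ) (hσ8 : σ < 1 / 8) (hT : IsFractionalCZO α K T) {C : ℝ≥0}
    (hC : ∀ f, MemVarLp p f → varNorm q (T f) ≤ C * varNorm p f)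
    (hphase : ∀ (X Y : EuclideanSpace ℝ (Fin n)) (t : ℝ), t ≠ 0 →
      X - Y = t • u → ∃ θ : 𝕜, ‖θ‖ = 1 ∧ ∀ x y, ‖x - X‖ ≤ σ * |t| → ‖y - Y‖ ≤ σ * |t| →
        a / 2 / |t| ^ ((n : ℝ) - α) ≤ RCLike.re (θ * K x y)) :
    ∃ k : ℕ, 0 < k ∧ volume {x | p x ≤ ENNReal.ofReal (1 + ((k : ℝ) * n)⁻¹)} = 0 := by
  have hn0 : (0 : ℝ) < n := by exact_mod_cast hn
  set v := volume.real (Metric.closedBall (0 : EuclideanSpace ℝ (Fin n)) σ) with hv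
  have hv0 : 0 < v := ENNReal.toReal_pos (Metric.measure_closedBall_pos _ _ hσ).ne'
    measure_closedBall_lt_top.ne
  obtain ⟨k, hk, hε⟩ := exists_block_length ha hσ hv0 ((div_lt_one hn0).2 hαn) C
  set ε := 2 * (ENNReal.ofReal ((k * v) ^ (α / n)) * (ENNReal.ofReal (4 / (a * (k * v))) * C))
  refine ⟨k, hk, ?_⟩
  by_contra hne
  obtain ⟨E, hEsub, hE, hEae⟩ := (hp.measurable.nullMeasurable (measurableSet_Iic
    (a := ENNReal.ofReal (1 + ((k : ℝ) * n)⁻¹)))).exists_measurable_subset_ae_eq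
  have hE0 : volume E ≠ 0 := by rwa [measure_congr hEae]
  obtain ⟨c⟩ := exists_ballChain hE hE0 hu hσ hσ8
  obtain ⟨D, hD⟩ := c.varNorm_block_le_geometric (𝕜 := 𝕜) hp hn hk fun x hx => hEsub hx
  set b : ℕ → ℝ≥0∞ := fun j =>
    varNorm p (stepFun (natBlock k j) c.piece fun i => (((c.dist i ^ n)⁻¹ : ℝ) : 𝕜))
  have hstep : ∀ j, b j ≤ ε * b (j + 1) := fun j =>
    (c.varNorm_block_le_succ hp hq hn hα hpq ha hT hC hphase hk j).trans_eq (by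
      simp only [ε, b]; ring)
  clear_value ε
  have hiter : ∀ j, b 0 ≤ ε ^ j * b j := by
    intro j
    induction j with
    | zero => simp
    | succ j ih =>
      refine ih.trans ?_
      rw [pow_succ, mul_assoc]
      gcongr
      exact hstep j
  have hb0 : b 0 = 0 := by
    refine ENNReal.eq_zero_of_forall_le_mul_pow (C := ENNReal.ofReal D) ENNReal.ofReal_ne_top hε
      fun j => (hiter j).trans ?_
    rw [mul_pow, mul_left_comm]
    exact mul_le_mul_right (hD j) _
  have hd := c.dist_pos (0 * k)
  have hpos : 0 < volume.real (c.piece (0 * k)) :=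
    lt_of_lt_of_le (by positivity) (c.le_volume_piece (0 * k))
  -- The norm of the first block is positive: the step function is at least `1` on a piece of
  -- positive measure, and `Q = 1` is admissible for any exponent.
  have hlow := le_varNorm_of_le_exponent le_rfl hp (c.measurableSet_piece (0 * k))
    (fun x _ => by rw [ENNReal.ofReal_one]; exact hp.one_le x) (w := 1)
    (m := min 1 (volume.real (c.piece (0 * k))))
    (f := stepFun (natBlock k 0) c.piece fun i => (((c.dist i ^ n)⁻¹ : ℝ) : 𝕜)) one_pos
    (lt_min one_pos hpos) (min_le_left _ _) (by
      rw [ENNReal.ofReal_le_iff_le_toReal (c.volume_piece_ne_top _)]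
      exact min_le_right _ _) fun x hx => by
      rw [stepFun_of_mem c.disjoint_piece (mul_mem_natBlock hk 0) hx, RCLike.norm_ofReal,
        abs_of_pos (by positivity), one_le_inv₀ (by positivity)]
      exact pow_le_one₀ hd.le (c.dist_le_one _)
  change _ ≤ b 0 at hlow
  rw [hb0, nonpos_iff_eq_zero, ENNReal.ofReal_eq_zero, one_mul] at hlow
  have : 0 < min 1 (volume.real (c.piece (0 * k))) ^ (1 : ℝ)⁻¹ :=
    Real.rpow_pos_of_pos (lt_min one_pos hpos) _
  linarith

lemma exists_volume_le_exponent_eq_zero (hp : IsExponent p) (hq : IsExponent q) (hn : 0 < n)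
    (hα : 0 ≤ α) (hαn : α < n)
    (hpq : ∀ᵐ x, (p x)⁻¹ = (q x)⁻¹ + ENNReal.ofReal (α / n)) (ha : 0 < a) (hu : ‖u‖ = 1)
    (hσ : 0 < σ) (hσ8 : σ < 1 / 8) (hT : IsFractionalCZO α K T) {C : ℝ≥0}
    (hC : ∀ f, MemVarLp p f → varNorm q (T f) ≤ C * varNorm p f)
    (hphase : ∀ (X Y : EuclideanSpace ℝ (Fin n)) (t : ℝ), t ≠ 0 →
      X - Y = t • u → ∃ θ : 𝕜, ‖θ‖ = 1 ∧ ∀ x y, ‖x - X‖ ≤ σ * |t| → ‖y - Y‖ ≤ σ * |t| →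
        a / 2 / |t| ^ ((n : ℝ) - α) ≤ RCLike.re (θ * K x y)) :
    ∃ k : ℕ, 0 < k ∧ volume {x | ENNReal.ofReal ((k : ℝ) * n) ≤ q x} = 0 := by
  have hn0 : (0 : ℝ) < n := by exact_mod_cast hn
  set v := volume.real (Metric.closedBall (0 : EuclideanSpace ℝ (Fin n)) σ) with hv
  have hv0 : 0 < v := ENNReal.toReal_pos (Metric.measure_closedBall_pos _ _ hσ).ne'
    measure_closedBall_lt_top.ne
  obtain ⟨k, hk, hε⟩ := exists_block_length ha hσ hv0 ((div_lt_one hn0).2 hαn) C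
  set ε := 2 * (ENNReal.ofReal ((k * v) ^ (α / n)) * (ENNReal.ofReal (4 / (a * (k * v))) * C))
  refine ⟨k, hk, ?_⟩
  by_contra hne
  obtain ⟨E, hEsub, hE, hEae⟩ := (hq.measurable.nullMeasurable (measurableSet_Ici
    (a := ENNReal.ofReal ((k : ℝ) * n)))).exists_measurable_subset_ae_eq
  have hE0 : volume E ≠ 0 := by rwa [measure_congr hEae]
  obtain ⟨c⟩ := exists_ballChain hE hE0 hu hσ hσ8
  obtain ⟨d, hd0, hd⟩ := c.geometric_le_varNorm_block (𝕜 := 𝕜) hq hn hk fun x hx => hEsub hx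
  set b : ℕ → ℝ≥0∞ := fun j => varNorm q (stepFun (natBlock k j) c.piece fun _ => (1 : 𝕜))
  have hstep : ∀ j, b (j + 1) ≤ ε * b j := fun j =>
    (c.varNorm_block_succ_le hp hq hn hα hpq ha hT hC hphase hk j).trans_eq (by
      simp only [ε, b]; ring)
  clear_value ε
  have hiter : ∀ j, b j ≤ ε ^ j * b 0 := by
    intro j
    induction j with
    | zero => simp
    | succ j ih =>
      refine (hstep j).trans ?_
      rw [pow_succ', mul_assoc]
      gcongr
  -- Finiteness of the first norm is what lets the decay `ε ^ j` conflict with the lower bound.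
  have hb0 : b 0 ≠ ∞ := by
    have hvol : volume (⋃ i ∈ natBlock k 0, c.piece i) ≠ ∞ :=
      ((measure_biUnion_finset_le _ _).trans_lt
        (ENNReal.sum_lt_top.2 fun i _ => (c.volume_piece_ne_top i).lt_top)).ne
    refine ((varNorm_le_max_one hq).trans_lt (max_lt ENNReal.one_lt_top
      ((varModular_le_of_le_indicator hq (Finset.measurableSet_biUnion (natBlock k 0)
        fun i _ => c.measurableSet_piece i) fun x => ?_).trans_lt
        (ENNReal.add_lt_top.2 ⟨hvol.lt_top, ENNReal.one_lt_top⟩)))).ne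
    by_cases hx : ∃ i ∈ natBlock k 0, x ∈ c.piece i
    · obtain ⟨i, hi, hxi⟩ := hx
      rw [stepFun_of_mem c.disjoint_piece hi hxi, Set.indicator_of_mem (Set.mem_iUnion₂.2 ⟨i, hi, hxi⟩)]
      simp
    · push Not at hx
      rw [stepFun_of_notMem hx, enorm_zero]
      exact zero_le
  have hd' : ENNReal.ofReal d = 0 := by
    refine ENNReal.eq_zero_of_forall_le_mul_pow (C := b 0) hb0 hε fun j => ?_
    have hr := c.ratio_pos
    calc ENNReal.ofReal d = ENNReal.ofReal (d * (σ / 2) ^ j) * ENNReal.ofReal (σ / 2)⁻¹ ^ j := by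
          rw [← ENNReal.ofReal_pow (by positivity), ← ENNReal.ofReal_mul (by positivity),
            mul_assoc, ← mul_pow, mul_inv_cancel₀ hr.ne', one_pow, mul_one]
      _ ≤ (ε ^ j * b 0) * ENNReal.ofReal (σ / 2)⁻¹ ^ j := by
          gcongr
          exact (hd j).trans (hiter j)
      _ = _ := by rw [mul_pow]; ring
  rw [ENNReal.ofReal_eq_zero] at hd'
  linarith

end

theorem mainTheorem2 {𝕜 : Type*} [RCLike 𝕜] {n : ℕ} {α : ℝ} (hα : 0 ≤ α) (hαn : α < n)
    {p q : EuclideanSpace ℝ (Fin n) → ℝ≥0∞} (hp : IsExponent p) (hq : IsExponent q)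
    (hpq : ∀ᵐ x, (p x)⁻¹ = (q x)⁻¹ + ENNReal.ofReal (α / n))
    (K : EuclideanSpace ℝ (Fin n) → EuclideanSpace ℝ (Fin n) → 𝕜)
    (T : (EuclideanSpace ℝ (Fin n) → 𝕜) → (EuclideanSpace ℝ (Fin n) → 𝕜))
    (hT : IsFractionalCZO α K T) (hK : IsNondegenerateKernel α K)
    (hstrong : StrongType p q T) :
    1 < essInf p volume ∧ essInf p volume ≤ essSup p volume ∧
      essSup p volume < (n : ℝ≥0∞) / ENNReal.ofReal α := by
  have hn0 : (0 : ℝ) < n := hα.trans_lt hαn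
  have hn : 0 < n := by exact_mod_cast hn0
  obtain ⟨a, u, ha, hu, hnd⟩ := hK
  obtain ⟨C, hC⟩ := hstrong
  obtain ⟨σ, hσ, hσ8, hphase⟩ := hT.1.exists_phase hαn ha hu hnd
  refine ⟨?_, ?_, ?_⟩
  · obtain ⟨k, hk, h⟩ := exists_volume_exponent_le_eq_zero hp hq hn hα hαn hpq ha hu hσ hσ8 hT
      (fun f hf => (hC f hf).2) hphase
    have hk0 : (0 : ℝ) < k := by exact_mod_cast hk
    refine lt_of_lt_of_le (b := ENNReal.ofReal (1 + ((k : ℝ) * n)⁻¹)) ?_ ?_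
    · rw [ENNReal.one_lt_ofReal]
      have : 0 < ((k : ℝ) * n)⁻¹ := by positivity
      linarith
    · refine le_essInf_of_ae_le _ ?_
      have h' : ∀ᵐ x, ¬ p x ≤ ENNReal.ofReal (1 + ((k : ℝ) * n)⁻¹) := by
        rw [ae_iff]; simpa only [not_not] using h
      filter_upwards [h'] with x hx using (not_le.1 hx).le
  · exact Filter.liminf_le_limsup
  · obtain ⟨k, hk, h⟩ := exists_volume_le_exponent_eq_zero hp hq hn hα hαn hpq ha hu hσ hσ8 hT
      (fun f hf => (hC f hf).2) hphase
    have hk0 : (0 : ℝ) < k := by exact_mod_cast hk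
    set Q := ENNReal.ofReal ((k : ℝ) * n) with hQ
    have hQtop : Q⁻¹ ≠ 0 := ENNReal.inv_ne_zero.2 ENNReal.ofReal_ne_top
    have h' : ∀ᵐ x, ¬ Q ≤ q x := by
      rw [ae_iff]; simpa only [not_not] using h
    -- From `q ≤ Q < ∞`, `1 / p` exceeds `α / n` by at least `1 / Q > 0`; this covers `α = 0` too.
    refine lt_of_le_of_lt (b := (Q⁻¹ + ENNReal.ofReal (α / n))⁻¹) ?_ ?_
    · refine essSup_le_of_ae_le _ ?_
      filter_upwards [h', hpq] with x hx hpqx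
      rw [ENNReal.le_inv_iff_le_inv, hpqx]
      gcongr
      exact (not_le.1 hx).le
    · have e : (n : ℝ≥0∞) / ENNReal.ofReal α = (ENNReal.ofReal (α / n))⁻¹ := by
        rw [ENNReal.ofReal_div_of_pos hn0, ENNReal.ofReal_natCast,
          ENNReal.inv_div (Or.inl (ENNReal.natCast_ne_top n)) (Or.inl (by exact_mod_cast hn.ne'))]
      rw [e, ENNReal.inv_lt_inv, add_comm]
      exact ENNReal.lt_add_right ENNReal.ofReal_ne_top hQtop
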